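/- For $n\ge 2$ let $N=n^2$ and consider the periodic grid $\mathbb Z_n\times\mathbb Z_n$. The walker's states are spanned by $|v,x,y\rangle$ with $v\in\{0,1\}$ and $(x,y)\in\mathbb Z_n^2$. Let $U=\Sigma_y(C_y\otimes I_N)\,\Sigma_x(C_x\otimes I_N)$ with $$C_x=\tfrac1{\sqrt2}\begin{pmatrix}1&i\\ i&1\end{pmatrix},\quad C_y=\tfrac1{\sqrt2}\begin{pmatrix}1&-i\\-i&1\end{pmatrix},\quad \Sigma_x|v,x,y\rangle=|v,x-(-1)^v,y\rangle,\quad \Sigma_y|v,x,y\rangle=|v,x,y-(-1)^v\rangle .$$ For a set $\mathcal M\subseteq\mathbb Z_n^2$ of marked vertices let $R=I-2\sum_{m\in\mathcal M}|d,m\rangle\langle d,m|$ with $|d\rangle=\frac{|0\rangle+|1\rangle}{\sqrt2}$, let $\psi(0)=\frac1{\sqrt{2N}}\sum_{v,x,y}|v,x,y\rangle$, and let the success probability after $t\in\mathbb N$ steps of the quantum-walk search be $p(t)=\sum_{m\in\mathcal M}|\langle d,m|(UR)^t|\psi(0)\rangle|^2$. The time complexity of the search is $T(\mathcal M)=\inf_{t\ge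 0}\frac{t+1}{p(t)}$, the expected cost of repeating, until success, a run of $t$ steps followed by one measurement, for the best choice of $t$. The search is called optimal for a family of configurations $(\mathcal M_n)_n$ if $T(\mathcal M_n)=O(\sqrt N\,(\ln N)^c)$ as $n\to\infty$ for some constant $c$. There are families of two-element configurations for which the search is not optimal. More specifically, for $\mathcal M=\{(0,0),(1,1)\}$ the following hold. 1. With $\theta_k=2\pi k/n$, the interference term $$\mathcal I=-\frac12\sum_{\substack{0\le k,l<n\\ \cos\theta_k\cos\theta_l\ne1}}\cos(\theta_k+\theta_l)\,\frac{\sin\theta_k\sin\theta_l}{1-\cos\theta_k\cos\theta_l}$$ satisfies $\mathcal I=\Theta(N)$ as $n\to\infty$. 2. The success probability is $O(1/N)$ whatever the number of steps: there is a constant $C$ such that $p(t)\le C/N$ for all $n\ge2$ and all $t\in\mathbb N$. 3. The time complexity is $T(\mathcal M)=\Theta(N)$, with positive constants valid for all $n\ge2$; in particular the search is not optimal for this configuration. -/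

import Mathlib

open scoped ENNReal

namespace QWSearch

noncomputable section

/-- Vertices of the periodic `n × n` grid; it has `N = n ^ 2` vertices. -/
abbrev Vertex (n : ℕ) : Type := ZMod n × ZMod n

/-- States of the walker: the amplitudes `α_{v,x,y}` on the basis `|v,x,y⟩`, where `v ∈ {0,1}` is
the coin state and `(x,y)` the position. -/
abbrev State (n : ℕ) : Type := Fin 2 → Vertex n → ℂ

/-- The coin for the direction `x`. -/
def coinX : Matrix (Fin 2) (Fin 2) ℂ :=
  ((1 / Real.sqrt 2 : ℝ) : ℂ) • !![1, Complex.I; Complex.I, 1]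

/-- The coin for the direction `y`. -/
def coinY : Matrix (Fin 2) (Fin 2) ℂ :=
  ((1 / Real.sqrt 2 : ℝ) : ℂ) • !![1, -Complex.I; -Complex.I, 1]

/-- The operator `C ⊗ I_N`. -/
def applyCoin {n : ℕ} (C : Matrix (Fin 2) (Fin 2) ℂ) (ψ : State n) : State n :=
  fun v p => ∑ w : Fin 2, C v w * ψ w p

/-- The conditional shift `|v⟩|x,y⟩ ↦ |v⟩|x - (-1)^v, y⟩`, on amplitudes. -/
def shiftX {n : ℕ} (ψ : State n) : State n :=
  fun v p => ψ v (p.1 + (-1) ^ (v : ℕ), p.2)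

/-- The conditional shift `|v⟩|x,y⟩ ↦ |v⟩|x, y - (-1)^v⟩`, on amplitudes. -/
def shiftY {n : ℕ} (ψ : State n) : State n :=
  fun v p => ψ v (p.1, p.2 + (-1) ^ (v : ℕ))

/-- One step of the unperturbed walk, `U = Σ_y (C_y ⊗ I) Σ_x (C_x ⊗ I)`. -/
def walk {n : ℕ} (ψ : State n) : State n :=
  shiftY (applyCoin coinY (shiftX (applyCoin coinX ψ)))

/-- The diagonal coin state `|d⟩ = (|0⟩ + |1⟩) / √2`. -/
def diag : Fin 2 → ℂ := fun _ => ((1 / Real.sqrt 2 : ℝ) : ℂ)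

/-- The amplitude `⟨d,m|ψ⟩`. -/
def bra {n : ℕ} (m : Vertex n) (ψ : State n) : ℂ :=
  ∑ v : Fin 2, (starRingEnd ℂ) (diag v) * ψ v m

/-- The state `|d,m⟩`. -/
def ket {n : ℕ} (m : Vertex n) : State n :=
  fun v p => if p = m then diag v else 0

/-- The oracle `R = 1 - 2 ∑_{m ∈ M} |d,m⟩⟨d,m|`. -/
def oracle {n : ℕ} (M : Finset (Vertex n)) (ψ : State n) : State n :=
  fun v p => ψ v p - 2 * ∑ m ∈ M, bra m ψ * ket m v p

/-- The equal superposition of all `2 N` basis states. -/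
def initial (n : ℕ) : State n :=
  fun _ _ => ((1 / Real.sqrt (2 * (n : ℝ) ^ 2) : ℝ) : ℂ)

/-- The state `(U R)^t ψ(0)` after `t` steps of the search. -/
def stateAt {n : ℕ} (M : Finset (Vertex n)) (t : ℕ) : State n :=
  (fun ψ => walk (oracle M ψ))^[t] (initial n)

/-- The success probability `p(t) = ∑_{m ∈ M} |⟨d,m| (U R)^t |ψ(0)⟩|²`. -/
def successProb {n : ℕ} (M : Finset (Vertex n)) (t : ℕ) : ℝ :=
  ∑ m ∈ M, ‖bra m (stateAt M t)‖ ^ 2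

/-- The time complexity of the search with the best choice of the measurement time: the infimum
over `t` of the expected cost `(t + 1) / p(t)` of repeating, until success, a run of `t` steps
followed by one measurement (infinite when `p(t) = 0`). -/
def complexity {n : ℕ} (M : Finset (Vertex n)) : ℝ≥0∞ :=
  ⨅ t : ℕ, ((t : ℝ≥0∞) + 1) / ENNReal.ofReal (successProb M t)

/-- The search is optimal for a family of configurations if its time complexity is
`O(√N polylog N)`, where `N = n ^ 2`. -/
def IsOptimal (M : ∀ n : ℕ, Finset (Vertex n)) : Prop :=
  ∃ (c : ℕ) (C : ℝ), ∀ᶠ n : ℕ in Filter.atTop,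
    complexity (M n) ≤ ENNReal.ofReal (C * (n : ℝ) * Real.log ((n : ℝ) ^ 2) ^ c)

/-- The angle `θ_k = 2πk/n`. -/
def angle (n k : ℕ) : ℝ := 2 * Real.pi * k / n

open scoped Classical in
/-- The interference term `𝓘` of the configuration `{(0,0), (x,y)}` on the `n × n` grid. The modes
with `cos θ_k cos θ_l = 1`, that is, those of eigenvalue `1` of the walk, are left out. -/
def interference (n : ℕ) (x y : ℤ) : ℝ :=
  -(1 / 2) * ∑ q ∈ (Finset.range n ×ˢ Finset.range n).filter
      (fun q => Real.cos (angle n q.1) * Real.cos (angle n q.2) ≠ 1),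
    Real.cos (angle n q.1 * x + angle n q.2 * y) *
      (Real.sin (angle n q.1) * Real.sin (angle n q.2) /
        (1 - Real.cos (angle n q.1) * Real.cos (angle n q.2)))

/-- The configuration `{(0,0), (1,1)}`. -/
def diagonalPair (n : ℕ) : Finset (Vertex n) := {(0, 0), (1, 1)}

end

end QWSearch

/-! The point reflection `p ↦ (1,1) - p` together with a coin flip swaps the two marked vertices and
is a symmetry of walk, oracle and initial state (`FlipInvariant`). The marked amplitudes therefore
stay equal, and on the orbit the search is `W = U (1 - 2|s⟩⟨s|)` with the single vector `s =
pairVec`.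

Let `F(r) = ⟨s|(1 + rU)(1 - rU)⁻¹|s⟩`. The same function for `W` is `1/F` (`resolvent_reflection`).
By parity only the interference survives in `Im F(r)`, which tends to `2𝓘/N` as `r → 1`; its terms
all have one sign, so for `n ≥ 3` and `r ≥ 1/2` it is at least `1/16`, and `Re (1/F) ≤ 256 Re F`. In
turn `Re F(1 - ε)` is at most a constant times the mean over momenta of `ε/(ε² + ω²)` with `ω² =
(sin² θ_k + sin² θ_l)/2`. Summing over dyadic `ε` turns each kernel into `O(1/ω)`, a singularity
integrable in two dimensions, so the sum down to `ε` of order `1/N` is `O(1)`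
(`sum_dyadic_grid_le`).

This controls the amplitude uniformly in time (`norm_inner_pow_le`): telescoping resolvents of `W`
over the dyadic scales costs `O(1)` times the overlap `⟨s,ψ⟩`, of modulus `√2/n`, and the last scale
leaves a remainder `O(1/n)`. Hence `p(t) = O(1/N)`. Measuring at `t = 0` already succeeds with
probability `2/N`, so the complexity is of order `N`. -/

namespace QWSearch

/-! ### Rank-one reflections of a unitary: time-uniform amplitude bounds from resolvents. -/

section Resolvent

open scoped InnerProductSpace

variable {E : Type*} [NormedAddCommGroup E] [InnerProductSpace ℂ E]

/-- For a linear isometry `V` and `0 ≤ r < 1`, the operator `1 - r V` is onto. -/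
lemma exists_sub_smul_eq [FiniteDimensional ℂ E] (V : E →ₗᵢ[ℂ] E) {r : ℝ} (h0 : 0 ≤ r)
    (h1 : r < 1) (v : E) : ∃ z : E, z - (r : ℂ) • V z = v := by
  let T : E →ₗ[ℂ] E := LinearMap.id - (r : ℂ) • V.toLinearMap
  have hT : Function.Injective T := by
    rw [← LinearMap.ker_eq_bot, LinearMap.ker_eq_bot']
    intro z hz
    have hz' : z = (r : ℂ) • V z := by
      simpa [T, sub_eq_zero] using hz
    have hn : ‖z‖ = r * ‖z‖ := by
      conv_lhs => rw [hz', norm_smul, V.norm_map]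
      simp [abs_of_nonneg h0]
    have : ‖z‖ = 0 := by nlinarith [norm_nonneg z]
    simpa using this
  obtain ⟨z, hz⟩ := LinearMap.injective_iff_surjective.1 hT v
  exact ⟨z, by simpa [T] using hz⟩

/-- Take norms in `z - s = r V z`. The size of a resolvent vector is thus read off from the real
part of one matrix element. -/
lemma one_sub_sq_mul_norm_sq (V : E →ₗᵢ[ℂ] E) {r : ℝ} {s z : E} (hs : ‖s‖ = 1)
    (hz : z - (r : ℂ) • V z = s) : (1 - r ^ 2) * ‖z‖ ^ 2 = 2 * (⟪s, z⟫_ℂ).re - 1 := by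
  have h1 : z - s = (r : ℂ) • V z := by rw [← hz]; abel
  have h2 : ‖z - s‖ ^ 2 = r ^ 2 * ‖z‖ ^ 2 := by
    rw [h1, norm_smul, V.norm_map, mul_pow]
    simp
  have h3 := @norm_sub_sq ℂ E _ _ _ z s
  rw [hs, h2] at h3
  have h4 : RCLike.re ⟪z, s⟫_ℂ = (⟪s, z⟫_ℂ).re := inner_re_symm (𝕜 := ℂ) z s
  rw [h4] at h3
  linarith

/-- The adjoint of `1 - r W⁻¹` is `1 - r W`: a resolvent of `W⁻¹` at `s` can be traded for a factor
`1 - r W` on the other side. -/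
lemma inner_eq_inner_sub (W : E ≃ₗᵢ[ℂ] E) {r : ℝ} {s z : E}
    (hz : z - (r : ℂ) • W.symm z = s) (u : E) :
    ⟪s, u⟫_ℂ = ⟪z, u - (r : ℂ) • W u⟫_ℂ := by
  have h : ⟪W.symm z, u⟫_ℂ = ⟪z, W u⟫_ℂ := by
    rw [← W.inner_map_map (W.symm z) u]; simp
  rw [← hz, inner_sub_left, inner_sub_right, inner_smul_left, inner_smul_right, h]
  simp

lemma pow_apply_comm (W : E ≃ₗᵢ[ℂ] E) (t : ℕ) (v : E) : (W ^ t) (W v) = W ((W ^ t) v) := by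
  have : W ^ t * W = W * W ^ t := (Commute.pow_self W t).eq
  exact DFunLike.congr_fun this v

lemma inner_pow_sub_eq (W : E ≃ₗᵢ[ℂ] E) {r q : ℝ} {s x z u : E}
    (hz : z - (r : ℂ) • W.symm z = s) (hu : x - (r : ℂ) • W x = (q : ℂ) • u) (t : ℕ) :
    ⟪s, (W ^ t) x⟫_ℂ = q * ⟪z, (W ^ t) u⟫_ℂ := by
  rw [inner_eq_inner_sub W hz, ← pow_apply_comm, ← map_smul, ← map_sub, hu, map_smul,
    inner_smul_right]

lemma norm_inner_pow_le_mul (W : E ≃ₗᵢ[ℂ] E) {r q : ℝ} {s x z u : E} (hq : 0 ≤ q)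
    (hz : z - (r : ℂ) • W.symm z = s) (hu : x - (r : ℂ) • W x = (q : ℂ) • u) (t : ℕ) :
    ‖⟪s, (W ^ t) x⟫_ℂ‖ ≤ q * (‖z‖ * ‖u‖) := by
  rw [inner_pow_sub_eq W hz hu, norm_mul]
  have h := norm_inner_le_norm (𝕜 := ℂ) z ((W ^ t) u)
  rw [(W ^ t).norm_map] at h
  have h2 : ‖(q : ℂ)‖ = q := by simp [abs_of_nonneg hq]
  rw [h2]
  gcongr

/-- The resolvent of `W = U (1 - 2 |s⟩⟨s|)` at `s`, from the resolvent `y` of `U` at `s`. -/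
lemma resolvent_reflection (U W : E ≃ₗᵢ[ℂ] E) {s : E} (hs : ‖s‖ = 1)
    (hW : ∀ v, W v = U (v - (2 * ⟪s, v⟫_ℂ) • s)) {r : ℝ} {y : E}
    (hy : y - (r : ℂ) • U y = s) (hF : 2 * ⟪s, y⟫_ℂ - 1 ≠ 0) :
    ∃ x : E, x - (r : ℂ) • W x = s ∧
      2 * (⟪s, x⟫_ℂ).re - 1 = (2 * ⟪s, y⟫_ℂ - 1)⁻¹.re := by
  set F : ℂ := 2 * ⟪s, y⟫_ℂ - 1 with hFdef
  have hss : ⟪s, s⟫_ℂ = 1 := by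
    rw [inner_self_eq_norm_sq_to_K, hs]; simp
  have hsx : ⟪s, y - (1 + F⁻¹) • (y - s)⟫_ℂ = (1 + F⁻¹) / 2 := by
    rw [inner_sub_right, inner_smul_right, inner_sub_right, hss]
    have : ⟪s, y⟫_ℂ = (F + 1) / 2 := by rw [hFdef]; ring
    rw [this]
    field_simp
    ring
  -- Sherman–Morrison: the rank-one perturbation changes the resolvent by a multiple of `r U y = y -
  -- s`. The coefficient makes `2⟪s, x⟫ - 1 = F⁻¹`.
  refine ⟨y - (1 + F⁻¹) • (y - s), ?_, ?_⟩
  · rw [hW, hsx]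
    have hUy : (r : ℂ) • U y = y - s := by rw [← hy]; abel
    simp only [map_sub, map_smul, smul_sub, smul_smul]
    have e1 : ((r : ℂ) * (1 + F⁻¹)) • U y = (1 + F⁻¹) • (y - s) := by
      rw [mul_comm, mul_smul, hUy]
    rw [hUy, e1]
    module
  · rw [hsx]
    have : (1 + F⁻¹) / 2 = ((1 / 2 : ℝ) : ℂ) * (1 + F⁻¹) := by push_cast; ring
    rw [this, Complex.re_ofReal_mul]
    simp

/-- The amplitude at `s` of a search `W = U (1 - 2 |s⟩⟨s|)` started at a fixed vector of `U` is
controlled, uniformly in time, by the resolvent of `U` at dyadic distances from `1`. -/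
theorem norm_inner_pow_le [FiniteDimensional ℂ E] (U W : E ≃ₗᵢ[ℂ] E) {s ψ : E} (hs : ‖s‖ = 1)
    (hψ : ‖ψ‖ = 1) (hU : U ψ = ψ) (hW : ∀ v, W v = U (v - (2 * ⟪s, v⟫_ℂ) • s))
    (y : ℕ → E) (hy : ∀ j, y j - ((1 - (1 / 2) ^ (j + 1) : ℝ) : ℂ) • U (y j) = s)
    (hF : ∀ j, 2 * ⟪s, y j⟫_ℂ - 1 ≠ 0) {B : ℝ} (J : ℕ)
    (hB : ∑ j ∈ Finset.range (J + 1), (2 * ⟪s, y j⟫_ℂ - 1)⁻¹.re ≤ B) (t : ℕ) :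
    ‖⟪s, (W ^ t) ψ⟫_ℂ‖ ≤
      √((1 / 2) ^ (J + 1) * B) + 2 * ‖⟪s, ψ⟫_ℂ‖ * (√(2 * B) + B) := by
  set P : ℕ → ℝ := fun j => (2 * ⟪s, y j⟫_ℂ - 1)⁻¹.re with hP
  set ε : ℕ → ℝ := fun j => (1 / 2) ^ (j + 1) with hε
  have hε0 : ∀ j, 0 < ε j := fun j => by positivity
  have hε1 : ∀ j, ε j ≤ 1 / 2 := fun j => by
    have : (1 / 2 : ℝ) ^ (j + 1) ≤ (1 / 2) ^ 1 :=
      pow_le_pow_of_le_one (by norm_num) (by norm_num) (by omega)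
    simpa [hε] using this
  have hεs : ∀ j, ε (j + 1) = ε j / 2 := fun j => by simp only [hε, pow_succ]; ring
  choose x hx hxP using fun j => resolvent_reflection U W hs hW (hy j) (hF j)
  have hzex : ∀ j, ∃ z : E, z - ((1 - ε j : ℝ) : ℂ) • W.symm z = s := fun j =>
    exists_sub_smul_eq W.symm.toLinearIsometry (by linarith [hε1 j]) (by linarith [hε0 j]) s
  choose z hz using hzex
  have hfac : ∀ j, ε j ≤ 1 - (1 - ε j) ^ 2 := fun j => by nlinarith [hε0 j, hε1 j]
  have hxn : ∀ j, ε j * ‖x j‖ ^ 2 ≤ P j := fun j => by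
    have h := one_sub_sq_mul_norm_sq W.toLinearIsometry hs (hx j)
    rw [hxP] at h
    calc ε j * ‖x j‖ ^ 2 ≤ (1 - (1 - ε j) ^ 2) * ‖x j‖ ^ 2 := by
          gcongr; exact hfac j
      _ = P j := h
  have hzn : ∀ j, ε j * ‖z j‖ ^ 2 ≤ P j := fun j => by
    have h := one_sub_sq_mul_norm_sq W.symm.toLinearIsometry hs (hz j)
    -- The resolvents of `W` and `W⁻¹` at `s` have conjugate matrix elements, so `P j` controls both
    -- `x j` and `z j`.
    have h2 : (⟪s, z j⟫_ℂ).re = (⟪s, x j⟫_ℂ).re := by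
      rw [inner_eq_inner_sub W (hz j) (x j), hx j]
      exact inner_re_symm (𝕜 := ℂ) s (z j)
    rw [h2, hxP] at h
    calc ε j * ‖z j‖ ^ 2 ≤ (1 - (1 - ε j) ^ 2) * ‖z j‖ ^ 2 := by
          gcongr; exact hfac j
      _ = P j := h
  have hP0 : ∀ j, 0 ≤ P j := fun j => le_trans (by have := hε0 j; positivity) (hxn j)
  have hPB : ∀ j ∈ Finset.range (J + 1), P j ≤ B := fun j hj =>
    (Finset.single_le_sum (fun i _ => hP0 i) hj).trans hB
  -- Resolvent identity: `x (j + 1) - x j` is the resolvent at scale `ε (j + 1)` applied to `(ε j /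
  -- 2) W (x j)`. Moving that resolvent onto `s` gives `(ε j / 2) ‖z (j + 1)‖ ‖x j‖`, and AM-GM
  -- separates the two factors.
  have hstep : ∀ j T, ‖⟪s, (W ^ T) (x (j + 1) - x j)⟫_ℂ‖ ≤ (P j + P (j + 1)) / 2 := by
    intro j T
    have hu : (x (j + 1) - x j) - ((1 - ε (j + 1) : ℝ) : ℂ) • W (x (j + 1) - x j)
        = ((ε j / 2 : ℝ) : ℂ) • W (x j) := by
      have e1 := hx (j + 1)
      have e2 := hx j
      rw [← e2] at e1
      have e3 : x (j + 1) = ((1 - ε (j + 1) : ℝ) : ℂ) • W (x (j + 1)) +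
          (x j - ((1 - ε j : ℝ) : ℂ) • W (x j)) := by rw [← e1]; abel
      have e4 : ((1 - ε (j + 1) : ℝ) : ℂ) = ((1 - ε j : ℝ) : ℂ) + ((ε j / 2 : ℝ) : ℂ) := by
        rw [hεs, ← Complex.ofReal_add]; congr 1; ring
      rw [map_sub, smul_sub]
      nth_rewrite 1 [e3]
      rw [show ((1 - ε (j + 1) : ℝ) : ℂ) • W (x j) = (((1 - ε j : ℝ) : ℂ) + ((ε j / 2 : ℝ) : ℂ)) •
        W (x j) by rw [e4], add_smul]
      abel
    have h := norm_inner_pow_le_mul W (by linarith [hε0 j]) (hz (j + 1)) hu T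
    rw [W.norm_map] at h
    refine h.trans ?_
    have h1 := hxn j
    have h2 := hzn (j + 1)
    rw [hεs] at h2
    nlinarith [mul_nonneg (hε0 j).le (sq_nonneg (‖z (j + 1)‖ - ‖x j‖)),
      mul_nonneg (hε0 j).le (sq_nonneg ‖x j‖), mul_nonneg (hε0 j).le (sq_nonneg ‖z (j + 1)‖),
      hP0 j, hP0 (j + 1)]
  have hsum : ∀ T K, ‖⟪s, (W ^ T) (x K)⟫_ℂ‖ ≤
      ‖x 0‖ + ∑ j ∈ Finset.range K, (P j + P (j + 1)) / 2 := by
    intro T K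
    induction K with
    | zero =>
      have h := norm_inner_le_norm (𝕜 := ℂ) s ((W ^ T) (x 0))
      rw [(W ^ T).norm_map, hs, one_mul] at h
      simpa using h
    | succ K ih =>
      have e : (W ^ T) (x (K + 1)) = (W ^ T) (x K) + (W ^ T) (x (K + 1) - x K) := by
        rw [← map_add]; congr 1; abel
      rw [e, inner_add_right, Finset.sum_range_succ, ← add_assoc]
      exact (norm_add_le _ _).trans (add_le_add ih (hstep K T))
  have hsumB : ∑ j ∈ Finset.range J, (P j + P (j + 1)) / 2 ≤ B := by
    have e1 : ∑ j ∈ Finset.range J, P j ≤ B := by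
      rw [Finset.sum_range_succ] at hB
      linarith [hP0 J]
    have e2 : ∑ j ∈ Finset.range J, P (j + 1) ≤ B := by
      rw [Finset.sum_range_succ'] at hB
      linarith [hP0 0]
    rw [← Finset.sum_div, Finset.sum_add_distrib]
    linarith
  have hx0 : ‖x 0‖ ≤ √(2 * B) := by
    apply Real.le_sqrt_of_sq_le
    have h1 := hxn 0
    have h2 := hPB 0 (by simp)
    have h3 : ε 0 = 1 / 2 := by simp [hε]
    rw [h3] at h1
    linarith
  have hWs : W s = -U s := by
    rw [hW, inner_self_eq_norm_sq_to_K, hs, ← map_neg]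
    congr 1
    simp only [Complex.coe_algebraMap, Complex.ofReal_one, one_pow, mul_one]
    module
  have hWψ : W ψ = ψ + (2 * ⟪s, ψ⟫_ℂ) • W s := by
    rw [hWs, hW, map_sub, hU, map_smul]
    module
  -- This vector is `ε (1 - (1 - ε) W)⁻¹ W ψ` with `ε = ε J`, the Abel mean of the orbit of `W ψ`.
  -- It is almost fixed by `W`, which makes its amplitude small at all times.
  have hend : ‖⟪s, (W ^ t) (ψ + (2 * ⟪s, ψ⟫_ℂ) • W (x J))⟫_ℂ‖ ≤ √(ε J * B) := by
    have hu : (ψ + (2 * ⟪s, ψ⟫_ℂ) • W (x J)) - ((1 - ε J : ℝ) : ℂ) •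
        W (ψ + (2 * ⟪s, ψ⟫_ℂ) • W (x J)) = (ε J : ℂ) • W ψ := by
      have e1 : W (x J) = W s + ((1 - ε J : ℝ) : ℂ) • W (W (x J)) := by
        rw [← map_smul, ← map_add]
        congr 1
        nth_rewrite 1 [← hx J]
        abel
      rw [map_add, map_smul]
      nth_rewrite 1 [e1]
      have e2 : (2 * ⟪s, ψ⟫_ℂ) • W s = W ψ - ψ := by rw [hWψ]; abel
      rw [smul_add, e2]
      push_cast
      module
    have h := norm_inner_pow_le_mul W (hε0 J).le (hz J) hu t
    rw [W.norm_map, hψ, mul_one] at h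
    refine h.trans (Real.le_sqrt_of_sq_le ?_)
    have h1 := hzn J
    have h2 := hPB J (by simp)
    nlinarith [hε0 J]
  have hdec : (W ^ t) ψ = (W ^ t) (ψ + (2 * ⟪s, ψ⟫_ℂ) • W (x J)) -
      (2 * ⟪s, ψ⟫_ℂ) • (W ^ (t + 1)) (x J) := by
    have : (W ^ (t + 1)) (x J) = (W ^ t) (W (x J)) := by rw [pow_succ]; rfl
    rw [this, map_add, map_smul]
    abel
  rw [hdec, inner_sub_right, inner_smul_right]
  refine (norm_sub_le _ _).trans (add_le_add hend ?_)
  rw [norm_mul, norm_mul, Complex.norm_ofNat]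
  gcongr
  exact (hsum (t + 1) J).trans (add_le_add hx0 hsumB)

end Resolvent

/-! ### Dyadic Poisson sums over the grid of momenta. -/

section TrigSums

open Finset Real

lemma abs_sin_pi_mul_div_mod (n : ℕ) [NeZero n] (j : ℕ) :
    |sin (π * j / n)| = |sin (π * (j % n : ℕ) / n)| := by
  have hn : (n : ℝ) ≠ 0 := Nat.cast_ne_zero.2 (NeZero.ne n)
  have h : π * j / n = π * (j % n : ℕ) / n + (j / n : ℕ) * π := by
    have := congrArg (Nat.cast : ℕ → ℝ) (Nat.mod_add_div j n)
    push_cast at this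
    rw [← this]
    field_simp
  rw [h, sin_add_nat_mul_pi, abs_mul]
  simp

lemma min_div_le_sin {n j : ℕ} (hj : j < n) :
    2 * min (j : ℝ) (n - j) / n ≤ sin (π * j / n) := by
  have hn : (0 : ℝ) < n := Nat.cast_pos.2 (by omega)
  have key : ∀ x : ℝ, 0 ≤ x → 2 * x ≤ n → 2 * x / n ≤ sin (π * x / n) := by
    intro x h0 h1
    have h := mul_le_sin (x := π * x / n) (by positivity) (by
      rw [div_le_div_iff₀ hn two_pos]
      nlinarith [pi_pos])
    refine le_trans (le_of_eq ?_) h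
    field_simp
  have hj' : (j : ℝ) ≤ n := by exact_mod_cast hj.le
  rcases le_total (j : ℝ) (n - j) with h | h
  · rw [min_eq_left h]
    exact key j (by positivity) (by linarith)
  · rw [min_eq_right h]
    have e : sin (π * j / n) = sin (π * ((n : ℝ) - j) / n) := by
      rw [← sin_pi_sub]
      congr 1
      field_simp
    rw [e]
    exact key _ (by linarith) (by linarith)

lemma sin_pi_mul_div_pos {n j : ℕ} (h0 : 0 < j) (hj : j < n) :
    1 / (n : ℝ) ≤ sin (π * j / n) := by
  refine le_trans ?_ (min_div_le_sin hj)
  have h1 : (1 : ℝ) ≤ j := by exact_mod_cast h0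
  have h2 : (j : ℝ) + 1 ≤ n := by exact_mod_cast hj
  have : (1 : ℝ) ≤ min (j : ℝ) (n - j) := le_min h1 (by linarith)
  gcongr
  linarith

lemma angle_eq (n k : ℕ) : angle n k = π * ((2 * k : ℕ) : ℝ) / n := by
  simp only [angle, Nat.cast_mul, Nat.cast_ofNat]; ring

lemma sin_angle_eq_zero_or (n : ℕ) [NeZero n] (k : ℕ) :
    sin (angle n k) = 0 ∨ 1 / (n : ℝ) ≤ |sin (angle n k)| := by
  rw [← abs_eq_zero, angle_eq, abs_sin_pi_mul_div_mod]
  rcases Nat.eq_zero_or_pos (2 * k % n) with h | h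
  · left; simp [h]
  · right
    exact (sin_pi_mul_div_pos h (Nat.mod_lt _ (NeZero.pos n))).trans (le_abs_self _)

/-- The angles are the even multiples of `π/n` below `2π`, and `|sin|` has period `π`. Enlarging to
all multiples avoids a case split on the parity of `n`. -/
lemma sum_abs_sin_angle_le (n : ℕ) [NeZero n] {G : ℝ → ℝ} (hG : ∀ x, 0 ≤ G x) :
    ∑ k ∈ range n, G |sin (angle n k)| ≤ 2 * ∑ j ∈ range n, G |sin (π * j / n)| := by
  have hn : (n : ℝ) ≠ 0 := Nat.cast_ne_zero.2 (NeZero.ne n)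
  calc ∑ k ∈ range n, G |sin (angle n k)|
      = ∑ k ∈ range n, G |sin (π * ((2 * k : ℕ) : ℝ) / n)| := by
        simp only [angle_eq]
    _ = ∑ j ∈ ((range n).image (fun k => 2 * k) : Finset ℕ), G |sin (π * j / n)| := by
        rw [sum_image]
        intro a _ b _ h
        exact Nat.eq_of_mul_eq_mul_left two_pos h
    _ ≤ ∑ j ∈ range (n + n), G |sin (π * j / n)| := by
        apply sum_le_sum_of_subset_of_nonneg
        · intro j hj
          simp only [mem_image, mem_range] at hj ⊢
          omega
        · intro _ _ _; exact hG _
    _ = 2 * ∑ j ∈ range n, G |sin (π * j / n)| := by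
        rw [sum_range_add, two_mul]
        congr 1
        refine sum_congr rfl fun j _ => ?_
        have : π * ((n + j : ℕ) : ℝ) / n = π * j / n + π := by
          push_cast
          field_simp
          ring
        rw [this, sin_add_pi, abs_neg]

lemma sum_sin_angle_eq_zero_le (n : ℕ) [NeZero n] :
    ∑ k ∈ range n, (if sin (angle n k) = 0 then (1 : ℝ) else 0) ≤ 2 := by
  have h := sum_abs_sin_angle_le n (G := fun x => if x = 0 then 1 else 0)
    (fun x => by split_ifs <;> norm_num)
  simp only [abs_eq_zero] at h
  refine h.trans ?_
  rw [sum_eq_single 0]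
  · simp
  · intro j hj h0
    have := sin_pi_mul_div_pos (Nat.pos_of_ne_zero h0) (mem_range.1 hj)
    have hn : (0 : ℝ) < 1 / n := by
      have := NeZero.pos n
      positivity
    rw [if_neg (by linarith)]
  · intro h
    exact absurd (mem_range.2 (NeZero.pos n)) h

lemma sum_one_div_sqrt_le (n : ℕ) : ∑ j ∈ range n, 1 / √((j : ℝ) + 1) ≤ 2 * √n := by
  induction n with
  | zero => simp
  | succ n ih =>
    rw [sum_range_succ]
    have hp : 0 < √((n : ℝ) + 1) := sqrt_pos.2 (by positivity)
    have h1 : √((n : ℝ) + 1) ^ 2 = n + 1 := sq_sqrt (by positivity)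
    have h2 : √(n : ℝ) ^ 2 = n := sq_sqrt (by positivity)
    have h3 : 1 / √((n : ℝ) + 1) ≤ 2 * (√((n : ℝ) + 1) - √n) := by
      rw [div_le_iff₀ hp]
      nlinarith [sq_nonneg (√((n : ℝ) + 1) - √n)]
    push_cast
    linarith

/-- Away from the cutoff, `|sin|` is at least linear in the distance to the nearest zero, and `1/√x`
is integrable. The cutoff `1/n` keeps the zeros finite without affecting other momenta. -/
lemma sum_one_div_sqrt_max_le (n : ℕ) [NeZero n] :
    ∑ k ∈ range n, 1 / √(max |sin (angle n k)| (1 / n)) ≤ 8 * n := by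
  have hn : (0 : ℝ) < n := Nat.cast_pos.2 (NeZero.pos n)
  refine (sum_abs_sin_angle_le n (G := fun x => 1 / √(max x (1 / n)))
    (fun x => by positivity)).trans ?_
  have hterm : ∀ j ∈ range n, 1 / √(max |sin (π * j / n)| (1 / n)) ≤
      √n * (1 / √((j : ℝ) + 1) + 1 / √(((n - 1 - j : ℕ) : ℝ) + 1)) := by
    intro j hj
    have hj := mem_range.1 hj
    have hcast : ((n - 1 - j : ℕ) : ℝ) + 1 = n - j := by
      rw [Nat.cast_sub (by omega), Nat.cast_sub (by omega)]; push_cast; ring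
    rw [hcast]
    have hj' : (j : ℝ) + 1 ≤ n := by exact_mod_cast hj
    have hmin : min ((j : ℝ) + 1) (n - j) / n ≤ max |sin (π * j / n)| (1 / n) := by
      rcases Nat.eq_zero_or_pos j with rfl | h0
      · refine le_trans ?_ (le_max_right _ _)
        gcongr
        simp
      · refine le_trans ?_ ((min_div_le_sin hj).trans ((le_abs_self _).trans (le_max_left _ _)))
        have h0' : (1 : ℝ) ≤ j := by exact_mod_cast h0
        gcongr
        rcases le_total (j : ℝ) (n - j) with h | h
        · rw [min_eq_left h]
          exact (min_le_left _ _).trans (by linarith)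
        · rw [min_eq_right h]
          exact (min_le_right _ _).trans (by linarith)
    have hpos : ∀ x : ℝ, 0 < x → x / n ≤ max |sin (π * j / n)| (1 / n) →
        1 / √(max |sin (π * j / n)| (1 / n)) ≤ √n * (1 / √x) := by
      intro x hx hle
      calc 1 / √(max |sin (π * j / n)| (1 / n)) ≤ 1 / √(x / n) := by gcongr
        _ = √n * (1 / √x) := by rw [sqrt_div hx.le]; field_simp
    rcases le_total ((j : ℝ) + 1) (n - j) with h | h
    · rw [min_eq_left h] at hmin
      refine (hpos _ (by positivity) hmin).trans ?_
      gcongr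
      linarith [show 0 ≤ 1 / √((n : ℝ) - j) by positivity]
    · rw [min_eq_right h] at hmin
      refine (hpos _ (by linarith) hmin).trans ?_
      gcongr
      linarith [show 0 ≤ 1 / √((j : ℝ) + 1) by positivity]
  have hsum := sum_le_sum hterm
  rw [← mul_sum, sum_add_distrib, sum_range_reflect (fun j : ℕ => 1 / √((j : ℝ) + 1)) n] at hsum
  have h := sum_one_div_sqrt_le n
  have hs : √(n : ℝ) * √n = n := mul_self_sqrt hn.le
  have h2 : √(n : ℝ) * (∑ j ∈ range n, 1 / √((j : ℝ) + 1) + ∑ j ∈ range n, 1 / √((j : ℝ) + 1)) ≤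
      √n * (2 * √n + 2 * √n) := by gcongr
  nlinarith

/-- The sum over dyadic scales of Poisson kernels at distance `ω` from the pole. -/
lemma sum_dyadic_poisson_le {ω : ℝ} (hω : 0 < ω) (J : ℕ) :
    ∑ j ∈ range J, (1 / 2 : ℝ) ^ (j + 1) / (((1 / 2) ^ (j + 1)) ^ 2 + ω ^ 2) ≤ 4 / ω := by
  -- Each kernel is dominated by an increment of `ε/(ε + ω)` between consecutive dyadic scales, so
  -- the sum telescopes.
  have hterm : ∀ j ∈ range J, (1 / 2 : ℝ) ^ (j + 1) / (((1 / 2) ^ (j + 1)) ^ 2 + ω ^ 2) ≤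
      4 / ω * ((1 / 2 : ℝ) ^ j / ((1 / 2) ^ j + ω) -
        (1 / 2 : ℝ) ^ (j + 1) / ((1 / 2) ^ (j + 1) + ω)) := by
    intro j _
    have h2 : (1 / 2 : ℝ) ^ j = 2 * (1 / 2) ^ (j + 1) := by rw [pow_succ]; ring
    rw [h2]
    have he : (0 : ℝ) < (1 / 2) ^ (j + 1) := by positivity
    generalize (1 / 2 : ℝ) ^ (j + 1) = e at he
    have e1 : 2 * e / (2 * e + ω) - e / (e + ω) = e * ω / ((2 * e + ω) * (e + ω)) := by
      field_simp
      ring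
    rw [e1, div_mul_div_comm, div_le_div_iff₀ (by positivity) (by positivity)]
    have : (2 * e + ω) * (e + ω) ≤ 4 * (e ^ 2 + ω ^ 2) := by nlinarith [sq_nonneg (e - ω)]
    nlinarith [mul_le_mul_of_nonneg_left this (mul_pos he hω).le]
  refine (sum_le_sum hterm).trans ?_
  rw [← mul_sum, sum_range_sub' (fun j : ℕ => (1 / 2 : ℝ) ^ j / ((1 / 2) ^ j + ω))]
  have h1 : (1 / 2 : ℝ) ^ 0 / ((1 / 2) ^ 0 + ω) ≤ 1 := by
    rw [div_le_one (by positivity)]; linarith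
  have h2 : 0 ≤ (1 / 2 : ℝ) ^ J / ((1 / 2) ^ J + ω) := by positivity
  have h3 : 0 < 4 / ω := by positivity
  nlinarith

/-- The case `ω = 0`: there the kernel is `1/ε`, and the number of scales has to be limited. -/
lemma sum_dyadic_inv_le (J : ℕ) :
    ∑ j ∈ range J, (1 / 2 : ℝ) ^ (j + 1) / (((1 / 2) ^ (j + 1)) ^ 2 + 0) ≤ 2 * 2 ^ J := by
  have hterm : ∀ j ∈ range J, (1 / 2 : ℝ) ^ (j + 1) / (((1 / 2) ^ (j + 1)) ^ 2 + 0) =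
      2 * 2 ^ j := by
    intro j _
    rw [add_zero, one_div, inv_pow, pow_succ]
    field_simp
  rw [sum_congr rfl hterm, ← mul_sum]
  have : ∑ j ∈ range J, (2 : ℝ) ^ j = 2 ^ J - 1 := by
    rw [geom_sum_eq (by norm_num)]; norm_num
  rw [this]
  linarith

/-- AM-GM replaces the conical singularity by a product `1/√|a| · 1/√|b|` of summable one-variable
singularities, so the double sum factors and no logarithm appears. -/
lemma one_div_sqrt_sq_add_sq_le {a b δ : ℝ} (hδ : 0 < δ) (ha : a = 0 ∨ δ ≤ |a|)
    (hb : b = 0 ∨ δ ≤ |b|) (h : ¬ (a = 0 ∧ b = 0)) :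
    1 / √((a ^ 2 + b ^ 2) / 2) ≤ 2 * (1 / √(max |a| δ) * (1 / √(max |b| δ))) := by
  have hA : 0 < max |a| δ := lt_max_of_lt_right hδ
  have hB : 0 < max |b| δ := lt_max_of_lt_right hδ
  have hsq : max |a| δ ^ 2 + max |b| δ ^ 2 ≤ 2 * (a ^ 2 + b ^ 2) := by
    rw [← sq_abs a, ← sq_abs b]
    rcases ha with rfl | ha <;> rcases hb with rfl | hb
    · exact absurd ⟨rfl, rfl⟩ h
    · rw [abs_zero, max_eq_right hδ.le, max_eq_left hb]
      nlinarith
    · rw [abs_zero, max_eq_right hδ.le, max_eq_left ha]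
      nlinarith
    · rw [max_eq_left ha, max_eq_left hb]
      nlinarith [sq_nonneg |a|, sq_nonneg |b|]
  have hle : √(max |a| δ) * √(max |b| δ) ≤ 2 * √((a ^ 2 + b ^ 2) / 2) := by
    rw [← sqrt_mul hA.le]
    have h4 : (2 : ℝ) * √((a ^ 2 + b ^ 2) / 2) = √(2 ^ 2 * ((a ^ 2 + b ^ 2) / 2)) := by
      rw [sqrt_mul (by positivity), sqrt_sq (by norm_num)]
    rw [h4]
    apply sqrt_le_sqrt
    nlinarith [sq_nonneg (max |a| δ - max |b| δ)]
  have hpa := sqrt_pos.2 hA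
  have hpb := sqrt_pos.2 hB
  have hS : 0 < √((a ^ 2 + b ^ 2) / 2) := by
    have := mul_pos hpa hpb
    linarith
  rw [div_mul_div_comm, one_mul, ← mul_div_assoc, mul_one, div_le_div_iff₀ hS (by positivity)]
  linarith

/-- The Poisson sums of the Dirac-type dispersion relation over the grid of momenta are summable
over the dyadic scales down to `1 / n ^ 2`. -/
theorem sum_dyadic_grid_le (n : ℕ) [NeZero n] {J : ℕ} (hJ : 2 ^ J ≤ 2 * n ^ 2) :
    ∑ j ∈ range J, ∑ k ∈ range n, ∑ l ∈ range n, (1 / 2 : ℝ) ^ (j + 1) /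
      (((1 / 2) ^ (j + 1)) ^ 2 + (sin (angle n k) ^ 2 + sin (angle n l) ^ 2) / 2) ≤
      528 * (n : ℝ) ^ 2 := by
  have hn : (0 : ℝ) < n := Nat.cast_pos.2 (NeZero.pos n)
  have hJ' : (2 : ℝ) ^ J ≤ 2 * n ^ 2 := by exact_mod_cast hJ
  set z : ℕ → ℝ := fun k => if sin (angle n k) = 0 then (1 : ℝ) else 0 with hz
  set g : ℕ → ℝ := fun k => 1 / √(max |sin (angle n k)| (1 / n)) with hg
  have hz0 : ∀ k, 0 ≤ z k := fun k => by simp only [hz]; split_ifs <;> norm_num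
  have hg0 : ∀ k, 0 ≤ g k := fun k => by positivity
  have hterm : ∀ k l, ∑ j ∈ range J, (1 / 2 : ℝ) ^ (j + 1) /
      (((1 / 2) ^ (j + 1)) ^ 2 + (sin (angle n k) ^ 2 + sin (angle n l) ^ 2) / 2) ≤
      (4 * n ^ 2) * (z k * z l) + 8 * (g k * g l) := by
    intro k l
    by_cases h : sin (angle n k) = 0 ∧ sin (angle n l) = 0
    · have h1 : z k * z l = 1 := by simp [hz, h.1, h.2]
      have := sum_dyadic_inv_le J
      have hgg := mul_nonneg (hg0 k) (hg0 l)
      rw [h1, h.1, h.2]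
      norm_num at this ⊢
      linarith
    · have hw : 0 < (sin (angle n k) ^ 2 + sin (angle n l) ^ 2) / 2 := by
        rcases not_and_or.1 h with h | h <;> positivity
      have h1 := sum_dyadic_poisson_le (sqrt_pos.2 hw) J
      rw [sq_sqrt hw.le] at h1
      have h2 := one_div_sqrt_sq_add_sq_le (δ := 1 / n) (by positivity)
        (sin_angle_eq_zero_or n k) (sin_angle_eq_zero_or n l) h
      have hzz := mul_nonneg (hz0 k) (hz0 l)
      have h3 : 4 / √((sin (angle n k) ^ 2 + sin (angle n l) ^ 2) / 2) =
        4 * (1 / √((sin (angle n k) ^ 2 + sin (angle n l) ^ 2) / 2)) := by ring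
      rw [h3] at h1
      have : 0 ≤ 4 * (n : ℝ) ^ 2 * (z k * z l) := by positivity
      simp only [hg]
      linarith
  rw [sum_comm]
  have hswap : ∀ k, ∑ j ∈ range J, ∑ l ∈ range n, (1 / 2 : ℝ) ^ (j + 1) /
      (((1 / 2) ^ (j + 1)) ^ 2 + (sin (angle n k) ^ 2 + sin (angle n l) ^ 2) / 2) ≤
      ∑ l ∈ range n, ((4 * n ^ 2) * (z k * z l) + 8 * (g k * g l)) := by
    intro k
    rw [sum_comm]
    exact sum_le_sum fun l _ => hterm k l
  refine (sum_le_sum fun k _ => hswap k).trans ?_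
  have hZ := sum_sin_angle_eq_zero_le n
  have hG := sum_one_div_sqrt_max_le n
  have hZ0 : 0 ≤ ∑ k ∈ range n, z k := sum_nonneg fun k _ => hz0 k
  have hG0 : 0 ≤ ∑ k ∈ range n, g k := sum_nonneg fun k _ => hg0 k
  have e : ∑ k ∈ range n, ∑ l ∈ range n, ((4 * (n : ℝ) ^ 2) * (z k * z l) + 8 * (g k * g l)) =
      (4 * n ^ 2) * ((∑ k ∈ range n, z k) * ∑ k ∈ range n, z k) +
        8 * ((∑ k ∈ range n, g k) * ∑ k ∈ range n, g k) := by
    simp only [sum_add_distrib, ← mul_sum, ← sum_mul]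
  rw [e]
  have h1 := mul_le_mul hZ hZ hZ0 (by norm_num)
  have h2 := mul_le_mul hG hG hG0 (by positivity)
  -- The constant is `528 = 4 · 2 · 2 + 8 · 8 · 8`: the zero modes, at most two per coordinate, and
  -- the remaining momenta.
  have h3 := mul_le_mul_of_nonneg_left h1 (show (0 : ℝ) ≤ 4 * n ^ 2 by positivity)
  nlinarith

end TrigSums

/-! ### Parity in momentum space and the interference term. -/

section Momentum

open Finset Asymptotics

variable {n : ℕ} [NeZero n]

/-- `cos (2 π k / n)` for a momentum `k`. -/
noncomputable def cosZ (k : ZMod n) : ℝ := (ZMod.stdAddChar k).re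

/-- `sin (2 π k / n)` for a momentum `k`. -/
noncomputable def sinZ (k : ZMod n) : ℝ := (ZMod.stdAddChar k).im

lemma stdAddChar_natCast (j : ℕ) :
    ZMod.stdAddChar (j : ZMod n) = Complex.exp (angle n j * Complex.I) := by
  have h := ZMod.stdAddChar_coe (N := n) j
  rw [Int.cast_natCast] at h
  rw [h]
  congr 1
  simp only [angle]
  push_cast
  ring

lemma cosZ_natCast (j : ℕ) : cosZ (j : ZMod n) = Real.cos (angle n j) := by
  rw [cosZ, stdAddChar_natCast, Complex.exp_ofReal_mul_I_re]

lemma sinZ_natCast (j : ℕ) : sinZ (j : ZMod n) = Real.sin (angle n j) := by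
  rw [sinZ, stdAddChar_natCast, Complex.exp_ofReal_mul_I_im]

lemma stdAddChar_eq (k : ZMod n) : ZMod.stdAddChar k = cosZ k + sinZ k * Complex.I :=
  (Complex.re_add_im _).symm

lemma stdAddChar_neg (k : ZMod n) :
    ZMod.stdAddChar (-k) = (starRingEnd ℂ) (ZMod.stdAddChar k) := by
  rw [AddChar.map_neg_eq_conj]

lemma cosZ_neg (k : ZMod n) : cosZ (-k) = cosZ k := by simp [cosZ, stdAddChar_neg]

lemma sinZ_neg (k : ZMod n) : sinZ (-k) = -sinZ k := by simp [sinZ, stdAddChar_neg]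

lemma cosZ_sq_add_sinZ_sq (k : ZMod n) : cosZ k ^ 2 + sinZ k ^ 2 = 1 := by
  have h : ‖ZMod.stdAddChar k‖ = 1 := Circle.norm_coe (ZMod.toCircle k)
  have h2 := Complex.sq_norm (ZMod.stdAddChar k)
  rw [h, Complex.normSq_apply] at h2
  simp only [cosZ, sinZ]
  linarith

lemma sum_zmod_eq_sum_range {M : Type*} [AddCommMonoid M] (G : ZMod n → M) :
    ∑ k, G k = ∑ j ∈ range n, G (j : ZMod n) := by
  refine sum_nbij' ZMod.val (fun j : ℕ => (j : ZMod n)) ?_ ?_ ?_ ?_ ?_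
  · intro k _; exact mem_range.2 (ZMod.val_lt k)
  · intro _ _; exact mem_univ _
  · intro k _; simp
  · intro j hj; exact ZMod.val_cast_of_lt (mem_range.1 hj)
  · intro k _; simp

lemma sum_stdAddChar_mul (b : ZMod n) :
    ∑ k : ZMod n, ZMod.stdAddChar (k * b) = if b = 0 then (n : ℂ) else 0 := by
  rw [AddChar.sum_mulShift b (ZMod.isPrimitive_stdAddChar n), ZMod.card]
  simp

/-- For `n ≤ 2` every sine vanishes and there is no interference; this is where `n ≥ 3` enters. -/
lemma sum_sinZ_sq (hn : 3 ≤ n) : ∑ k : ZMod n, sinZ k ^ 2 = n / 2 := by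
  have h2 : (2 : ZMod n) ≠ 0 := by
    intro h
    have h' : ((2 : ℕ) : ZMod n) = 0 := by exact_mod_cast h
    rw [ZMod.natCast_eq_zero_iff] at h'
    exact absurd (Nat.le_of_dvd two_pos h') (by omega)
  have h := congrArg Complex.re (sum_stdAddChar_mul (2 : ZMod n))
  rw [if_neg h2, Complex.re_sum, Complex.zero_re] at h
  have hk : ∀ k : ZMod n, (ZMod.stdAddChar (k * 2)).re = 1 - 2 * sinZ k ^ 2 := by
    intro k
    rw [mul_two, AddChar.map_add_eq_mul, Complex.mul_re]
    have := cosZ_sq_add_sinZ_sq k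
    simp only [cosZ, sinZ] at this ⊢
    linarith
  simp only [hk, sum_sub_distrib, ← mul_sum, sum_const, card_univ, ZMod.card, nsmul_eq_mul,
    mul_one] at h
  linarith

lemma sum_cosZ_add (hn : 2 ≤ n) :
    ∑ k : ZMod n, ∑ l : ZMod n, (cosZ k * cosZ l - sinZ k * sinZ l) = 0 := by
  have : Fact (1 < n) := ⟨hn⟩
  have h := sum_stdAddChar_mul (1 : ZMod n)
  rw [if_neg one_ne_zero] at h
  simp only [mul_one] at h
  have h1 : ∑ k : ZMod n, cosZ k = 0 := by
    simpa [cosZ] using congrArg Complex.re h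
  have h2 : ∑ k : ZMod n, sinZ k = 0 := by
    simpa [sinZ] using congrArg Complex.im h
  simp only [sum_sub_distrib, ← mul_sum, h1, h2]
  simp

lemma sum_sinZ_mul_sinZ_eq_zero (f : ℝ → ℝ → ℝ) :
    ∑ k : ZMod n, ∑ l : ZMod n, sinZ k * sinZ l * f (cosZ k) (cosZ l) = 0 := by
  have h : ∑ k : ZMod n, ∑ l : ZMod n, sinZ k * sinZ l * f (cosZ k) (cosZ l) =
      ∑ k : ZMod n, ∑ l : ZMod n, sinZ (-k) * sinZ l * f (cosZ (-k)) (cosZ l) :=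
    (Equiv.sum_comp (Equiv.neg (ZMod n))
      (fun k => ∑ l : ZMod n, sinZ k * sinZ l * f (cosZ k) (cosZ l))).symm
  simp only [cosZ_neg, sinZ_neg, neg_mul, sum_neg_distrib] at h
  linarith

/-- Expand `cos (k + l)`: the product of cosines contributes a summand odd in `k`, which cancels.
What is left is a sum of squares weighted by `f`, so positive `f` permits no further cancellation.
-/
lemma sum_cos_add_mul (f : ℝ → ℝ) :
    ∑ k : ZMod n, ∑ l : ZMod n, (cosZ k * cosZ l - sinZ k * sinZ l) *
      (sinZ k * sinZ l * f (cosZ k * cosZ l)) =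
    -∑ k : ZMod n, ∑ l : ZMod n, sinZ k ^ 2 * sinZ l ^ 2 * f (cosZ k * cosZ l) := by
  have h := sum_sinZ_mul_sinZ_eq_zero (n := n) (fun c d => c * d * f (c * d))
  rw [← zero_sub, ← h, ← sum_sub_distrib]
  refine sum_congr rfl fun k _ => ?_
  rw [← sum_sub_distrib]
  exact sum_congr rfl fun l _ => by ring

lemma le_sum_sinZ_sq_mul (hn : 3 ≤ n) {f : ℝ → ℝ} {δ : ℝ}
    (hf : ∀ k l : ZMod n, δ * (sinZ k ^ 2 * sinZ l ^ 2) ≤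
      sinZ k ^ 2 * sinZ l ^ 2 * f (cosZ k * cosZ l)) :
    δ * (n : ℝ) ^ 2 / 4 ≤
      ∑ k : ZMod n, ∑ l : ZMod n, sinZ k ^ 2 * sinZ l ^ 2 * f (cosZ k * cosZ l) := by
  refine le_trans (le_of_eq ?_) (sum_le_sum fun k _ => sum_le_sum fun l _ => hf k l)
  simp only [← mul_sum, ← sum_mul, sum_sinZ_sq hn]
  ring

lemma one_sub_cosZ_mul (k l : ZMod n) :
    (sinZ k ^ 2 + sinZ l ^ 2) / 2 ≤ 1 - cosZ k * cosZ l := by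
  nlinarith [cosZ_sq_add_sinZ_sq k, cosZ_sq_add_sinZ_sq l, sq_nonneg (cosZ k - cosZ l)]

lemma neg_one_le_cosZ_mul (k l : ZMod n) : -1 ≤ cosZ k * cosZ l := by
  nlinarith [cosZ_sq_add_sinZ_sq k, cosZ_sq_add_sinZ_sq l, sq_nonneg (cosZ k + cosZ l),
    sq_nonneg (sinZ k), sq_nonneg (sinZ l)]

lemma cosZ_add_mem (k l : ZMod n) :
    -1 ≤ cosZ k * cosZ l - sinZ k * sinZ l ∧ cosZ k * cosZ l - sinZ k * sinZ l ≤ 1 := by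
  have h1 := cosZ_sq_add_sinZ_sq k
  have h2 := cosZ_sq_add_sinZ_sq l
  constructor
  · nlinarith [sq_nonneg (cosZ k + cosZ l), sq_nonneg (sinZ k - sinZ l)]
  · nlinarith [sq_nonneg (cosZ k - cosZ l), sq_nonneg (sinZ k + sinZ l)]

lemma interference_one_one (n : ℕ) [NeZero n] :
    interference n 1 1 =
      1 / 2 * ∑ k : ZMod n, ∑ l : ZMod n, sinZ k ^ 2 * sinZ l ^ 2 * (1 - cosZ k * cosZ l)⁻¹ := by
  have h := sum_cos_add_mul (n := n) (fun x => (1 - x)⁻¹)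
  have e : ∑ k : ZMod n, ∑ l : ZMod n, sinZ k ^ 2 * sinZ l ^ 2 * (1 - cosZ k * cosZ l)⁻¹ =
    -∑ k : ZMod n, ∑ l : ZMod n, (cosZ k * cosZ l - sinZ k * sinZ l) *
      (sinZ k * sinZ l * (1 - cosZ k * cosZ l)⁻¹) := by rw [h, neg_neg]
  rw [e, interference, sum_filter, sum_product, sum_zmod_eq_sum_range, mul_neg, neg_mul]
  congr 2
  refine sum_congr rfl fun k _ => ?_
  rw [sum_zmod_eq_sum_range]
  refine sum_congr rfl fun l _ => ?_
  simp only [cosZ_natCast, sinZ_natCast, Int.cast_one, mul_one, Real.cos_add]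
  split_ifs with hc
  · rw [div_eq_mul_inv]
  -- The omitted modes contribute zero to the full sum, since `0⁻¹ = 0`.
  · rw [not_not] at hc
    simp [hc]

theorem interference_isTheta :
    (fun n : ℕ => interference n 1 1) =Θ[Filter.atTop] fun n : ℕ => (n : ℝ) ^ 2 := by
  have key : ∀ n : ℕ, 3 ≤ n → (n : ℝ) ^ 2 / 16 ≤ interference n 1 1 ∧
      interference n 1 1 ≤ n ^ 2 := by
    intro n hn
    have : NeZero n := ⟨by omega⟩
    rw [interference_one_one]
    constructor
    · have := le_sum_sinZ_sq_mul hn (f := fun x => (1 - x)⁻¹) (δ := 1 / 2) (by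
        intro k l
        by_cases h : sinZ k ^ 2 * sinZ l ^ 2 = 0
        · simp [h]
        · have h1 := one_sub_cosZ_mul k l
          have h2 := neg_one_le_cosZ_mul k l
          have h3 : 0 < sinZ k ^ 2 := by
            have := left_ne_zero_of_mul h
            positivity
          rw [mul_comm]
          gcongr
          rw [one_div]
          apply inv_anti₀
          · nlinarith [sq_nonneg (sinZ l)]
          · linarith)
      linarith
    · have hterm : ∀ k l : ZMod n, sinZ k ^ 2 * sinZ l ^ 2 * (1 - cosZ k * cosZ l)⁻¹ ≤ 2 := by
        intro k l
        have h1 := one_sub_cosZ_mul k l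
        have h2 := cosZ_sq_add_sinZ_sq k
        have h3 : sinZ k ^ 2 ≤ 1 := by nlinarith [sq_nonneg (cosZ k)]
        have h4 := sq_nonneg (sinZ l)
        have h5 := sq_nonneg (sinZ k)
        rw [← div_eq_mul_inv]
        apply div_le_of_le_mul₀ <;> nlinarith
      have : ∑ k : ZMod n, ∑ l : ZMod n, sinZ k ^ 2 * sinZ l ^ 2 * (1 - cosZ k * cosZ l)⁻¹ ≤
          ∑ k : ZMod n, ∑ l : ZMod n, (2 : ℝ) :=
        sum_le_sum fun k _ => sum_le_sum fun l _ => hterm k l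
      simp only [sum_const, card_univ, ZMod.card, nsmul_eq_mul] at this
      nlinarith
  constructor
  · refine IsBigO.of_bound 1 ?_
    filter_upwards [Filter.eventually_ge_atTop 3] with n hn
    obtain ⟨h1, h2⟩ := key n hn
    have h3 : 0 ≤ (n : ℝ) ^ 2 := by positivity
    rw [Real.norm_of_nonneg h3, Real.norm_of_nonneg (h1.trans' (by positivity))]
    linarith
  · refine IsBigO.of_bound 16 ?_
    filter_upwards [Filter.eventually_ge_atTop 3] with n hn
    obtain ⟨h1, h2⟩ := key n hn
    have h3 : 0 ≤ (n : ℝ) ^ 2 := by positivity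
    rw [Real.norm_of_nonneg h3, Real.norm_of_nonneg (h1.trans' (by positivity))]
    linarith

/-- `sum_dyadic_grid_le` as a sum over `ZMod n`. -/
lemma sum_dyadic_zmod_le {J : ℕ} (hJ : 2 ^ J ≤ 2 * n ^ 2) :
    ∑ j ∈ range J, ∑ k : ZMod n, ∑ l : ZMod n, (1 / 2 : ℝ) ^ (j + 1) /
      (((1 / 2) ^ (j + 1)) ^ 2 + (sinZ k ^ 2 + sinZ l ^ 2) / 2) ≤ 528 * (n : ℝ) ^ 2 := by
  refine le_trans (le_of_eq ?_) (sum_dyadic_grid_le n hJ)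
  simp only [sum_zmod_eq_sum_range, sinZ_natCast]

end Momentum

/-! ### Unitarity, flip symmetry and reduction to one marked vector. -/

section Walk

open Finset

variable {n : ℕ}

lemma sqrt_two_inv_mul_self :
    ((1 / Real.sqrt 2 : ℝ) : ℂ) * ((1 / Real.sqrt 2 : ℝ) : ℂ) = 1 / 2 := by
  rw [← Complex.ofReal_mul, div_mul_div_comm, Real.mul_self_sqrt (by norm_num)]
  norm_num

lemma walk_apply_zero (ψ : State n) (p : Vertex n) :
    walk ψ 0 p = 1 / 2 * (ψ 0 (p.1 + 1, p.2 + 1) + Complex.I * ψ 1 (p.1 + 1, p.2 + 1)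
      + ψ 0 (p.1 - 1, p.2 + 1) - Complex.I * ψ 1 (p.1 - 1, p.2 + 1)) := by
  rw [← sqrt_two_inv_mul_self]
  simp [walk, shiftX, shiftY, applyCoin, coinX, coinY, Fin.sum_univ_two, ← sub_eq_add_neg]
  linear_combination (-((√2 : ℂ)⁻¹ * (√2 : ℂ)⁻¹ * ψ 0 (p.1 - 1, p.2 + 1))) * Complex.I_sq

lemma walk_apply_one (ψ : State n) (p : Vertex n) :
    walk ψ 1 p = 1 / 2 * (-Complex.I * ψ 0 (p.1 + 1, p.2 - 1) + ψ 1 (p.1 + 1, p.2 - 1)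
      + Complex.I * ψ 0 (p.1 - 1, p.2 - 1) + ψ 1 (p.1 - 1, p.2 - 1)) := by
  rw [← sqrt_two_inv_mul_self]
  simp [walk, shiftX, shiftY, applyCoin, coinX, coinY, Fin.sum_univ_two, ← sub_eq_add_neg]
  linear_combination (-((√2 : ℂ)⁻¹ * (√2 : ℂ)⁻¹ * ψ 1 (p.1 + 1, p.2 - 1))) * Complex.I_sq

/-- The walk as a linear map. -/
noncomputable def walkLin (n : ℕ) : State n →ₗ[ℂ] State n where
  toFun := walk
  map_add' ψ φ := by
    funext v p
    fin_cases v
    · simp only [Fin.zero_eta, Pi.add_apply, walk_apply_zero]; ring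
    · simp only [Fin.mk_one, Pi.add_apply, walk_apply_one]; ring
  map_smul' a ψ := by
    funext v p
    fin_cases v
    · simp only [Fin.zero_eta, Pi.smul_apply, walk_apply_zero, smul_eq_mul, RingHom.id_apply]; ring
    · simp only [Fin.mk_one, Pi.smul_apply, walk_apply_one, smul_eq_mul, RingHom.id_apply]; ring

@[simp] lemma walkLin_apply (ψ : State n) : walkLin n ψ = walk ψ := rfl

/-- Invariance under the point reflection that exchanges `(0,0)` with `(1,1)` and flips the coin. -/
def FlipInvariant (ψ : State n) : Prop := ∀ p : Vertex n, ψ 1 (1 - p.1, 1 - p.2) = ψ 0 p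

lemma FlipInvariant.symm {ψ : State n} (h : FlipInvariant ψ) (p : Vertex n) :
    ψ 0 (1 - p.1, 1 - p.2) = ψ 1 p := by
  rw [← h]; simp

lemma FlipInvariant.walk {ψ : State n} (h : FlipInvariant ψ) : FlipInvariant (walk ψ) := by
  intro p
  have f1 := h (p.1 + 1, p.2 + 1)
  have f2 := h (p.1 - 1, p.2 + 1)
  have g1 := h.symm (p.1 + 1, p.2 + 1)
  have g2 := h.symm (p.1 - 1, p.2 + 1)
  have e1 : ∀ x : ZMod n, 1 - (x + 1) = 1 - x - 1 := fun x => by ring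
  have e2 : ∀ x : ZMod n, 1 - (x - 1) = 1 - x + 1 := fun x => by ring
  simp only [e1, e2] at f1 f2 g1 g2
  rw [walk_apply_zero, walk_apply_one]
  linear_combination (1 / 2) * f1 + (1 / 2) * f2 + (Complex.I / 2) * g1 - (Complex.I / 2) * g2

lemma bra_eq (m : Vertex n) (ψ : State n) :
    bra m ψ = ((1 / Real.sqrt 2 : ℝ) : ℂ) * (ψ 0 m + ψ 1 m) := by
  simp only [bra, diag, Fin.sum_univ_two, Complex.conj_ofReal]
  ring

lemma FlipInvariant.bra_eq {ψ : State n} (h : FlipInvariant ψ) :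
    bra (1, 1) ψ = bra (0, 0) ψ := by
  have h1 := h (0, 0)
  have h2 := h.symm (0, 0)
  simp only [sub_zero] at h1 h2
  rw [QWSearch.bra_eq, QWSearch.bra_eq, h1, h2, add_comm]

lemma oracle_diagonalPair (hn : 2 ≤ n) (ψ : State n) :
    oracle (diagonalPair n) ψ =
      ψ - (2 : ℂ) • (bra (0, 0) ψ • ket (0, 0) + bra (1, 1) ψ • ket (1, 1)) := by
  have : Fact (1 < n) := ⟨hn⟩
  have hne : ((0, 0) : Vertex n) ≠ (1, 1) := by simp
  funext v p
  simp only [oracle, diagonalPair, sum_pair hne]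
  rfl

lemma FlipInvariant.oracle (hn : 2 ≤ n) {ψ : State n} (h : FlipInvariant ψ) :
    FlipInvariant (oracle (diagonalPair n) ψ) := by
  intro p
  have e1 : ket (0, 0) 1 ((1 - p.1, 1 - p.2) : Vertex n) = ket (1, 1) 0 p := by
    simp only [ket, diag]
    congr 1
    simp only [Prod.ext_iff, eq_iff_iff, sub_eq_zero]
    constructor <;> rintro ⟨h1, h2⟩ <;> exact ⟨h1.symm, h2.symm⟩
  have e2 : ket (1, 1) 1 ((1 - p.1, 1 - p.2) : Vertex n) = ket (0, 0) 0 p := by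
    simp only [ket, diag]
    congr 1
    simp [Prod.ext_iff]
  rw [oracle_diagonalPair hn]
  simp only [Pi.sub_apply, Pi.smul_apply, Pi.add_apply, h p, h.bra_eq, e1, e2, smul_eq_mul]
  ring

lemma flipInvariant_stateAt (hn : 2 ≤ n) (t : ℕ) :
    FlipInvariant (stateAt (diagonalPair n) t) := by
  induction t with
  | zero => intro p; rfl
  | succ t ih =>
    rw [stateAt, Function.iterate_succ_apply']
    exact (ih.oracle hn).walk

lemma walk_initial : walk (initial n) = initial n := by
  funext v p
  fin_cases v
  · simp only [Fin.zero_eta, walk_apply_zero, initial]; ring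
  · simp only [Fin.mk_one, walk_apply_one, initial]; ring

lemma bra_ket (m m' : Vertex n) : bra m (ket m') = if m = m' then 1 else 0 := by
  rw [bra_eq]
  simp only [ket, diag]
  split_ifs
  · linear_combination 2 * sqrt_two_inv_mul_self
  · simp

variable [NeZero n]

lemma sum_norm_sq_applyCoin_coinX (ψ : State n) :
    ∑ v, ∑ p, ‖applyCoin coinX ψ v p‖ ^ 2 = ∑ v, ∑ p, ‖ψ v p‖ ^ 2 := by
  simp only [Fin.sum_univ_two, ← sum_add_distrib]
  refine sum_congr rfl fun p _ => ?_
  have h2 : √(2 : ℝ) * √2 = 2 := Real.mul_self_sqrt (by norm_num)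
  simp only [Complex.sq_norm, Complex.normSq_apply]
  simp [applyCoin, coinX, Fin.sum_univ_two]
  linear_combination (1 / 2 * ((ψ 0 p).re ^ 2 + (ψ 0 p).im ^ 2 + (ψ 1 p).re ^ 2 +
    (ψ 1 p).im ^ 2)) * h2

lemma sum_norm_sq_applyCoin_coinY (ψ : State n) :
    ∑ v, ∑ p, ‖applyCoin coinY ψ v p‖ ^ 2 = ∑ v, ∑ p, ‖ψ v p‖ ^ 2 := by
  simp only [Fin.sum_univ_two, ← sum_add_distrib]
  refine sum_congr rfl fun p _ => ?_
  have h2 : √(2 : ℝ) * √2 = 2 := Real.mul_self_sqrt (by norm_num)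
  simp only [Complex.sq_norm, Complex.normSq_apply]
  simp [applyCoin, coinY, Fin.sum_univ_two]
  linear_combination (1 / 2 * ((ψ 0 p).re ^ 2 + (ψ 0 p).im ^ 2 + (ψ 1 p).re ^ 2 +
    (ψ 1 p).im ^ 2)) * h2

lemma sum_norm_sq_walk (ψ : State n) :
    ∑ v, ∑ p, ‖walk ψ v p‖ ^ 2 = ∑ v, ∑ p, ‖ψ v p‖ ^ 2 := by
  have hshift : ∀ (φ : State n) (a : Fin 2 → Vertex n),
      ∑ v, ∑ p, ‖φ v (p + a v)‖ ^ 2 = ∑ v, ∑ p, ‖φ v p‖ ^ 2 := fun φ a =>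
    sum_congr rfl fun v _ => Equiv.sum_comp (Equiv.addRight (a v)) (fun p => ‖φ v p‖ ^ 2)
  have hX : ∀ φ : State n, ∑ v, ∑ p, ‖shiftX φ v p‖ ^ 2 = ∑ v, ∑ p, ‖φ v p‖ ^ 2 := fun φ => by
    rw [← hshift φ (fun v => ((-1) ^ (v : ℕ), 0))]
    simp [shiftX, Prod.add_def]
  have hY : ∀ φ : State n, ∑ v, ∑ p, ‖shiftY φ v p‖ ^ 2 = ∑ v, ∑ p, ‖φ v p‖ ^ 2 := fun φ => by
    rw [← hshift φ (fun v => (0, (-1) ^ (v : ℕ)))]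
    simp [shiftY, Prod.add_def]
  rw [walk, hY, sum_norm_sq_applyCoin_coinY, hX, sum_norm_sq_applyCoin_coinX]

/-- The Hilbert space of the walker. -/
abbrev Walker (n : ℕ) : Type := EuclideanSpace ℂ (Fin 2 × Vertex n)

/-- States as vectors of the Hilbert space. -/
noncomputable def toWalker (n : ℕ) [NeZero n] : State n ≃ₗ[ℂ] Walker n :=
  (LinearEquiv.curry ℂ ℂ (Fin 2) (Vertex n)).symm ≪≫ₗ
    (WithLp.linearEquiv 2 ℂ (Fin 2 × Vertex n → ℂ)).symm

lemma norm_sq_toWalker (ψ : State n) : ‖toWalker n ψ‖ ^ 2 = ∑ v, ∑ p, ‖ψ v p‖ ^ 2 := by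
  rw [EuclideanSpace.norm_sq_eq, Fintype.sum_prod_type]
  rfl

lemma inner_toWalker (φ ψ : State n) :
    inner ℂ (toWalker n φ) (toWalker n ψ) = ∑ v, ∑ p, ψ v p * (starRingEnd ℂ) (φ v p) := by
  rw [PiLp.inner_apply, Fintype.sum_prod_type]
  rfl

/-- The walk as a unitary operator. -/
noncomputable def walkU (n : ℕ) [NeZero n] : Walker n ≃ₗᵢ[ℂ] Walker n :=
  LinearIsometry.toLinearIsometryEquiv
    { toLinearMap := (toWalker n).toLinearMap ∘ₗ walkLin n ∘ₗ (toWalker n).symm.toLinearMap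
      norm_map' := fun x => by
        obtain ⟨ψ, rfl⟩ := (toWalker n).surjective x
        rw [← sq_eq_sq₀ (norm_nonneg _) (norm_nonneg _)]
        simp only [LinearMap.comp_apply, LinearEquiv.coe_coe, LinearEquiv.symm_apply_apply,
          walkLin_apply]
        rw [norm_sq_toWalker, norm_sq_toWalker, sum_norm_sq_walk] } rfl

lemma walkU_toWalker (ψ : State n) : walkU n (toWalker n ψ) = toWalker n (walk ψ) := by
  change toWalker n (walk ((toWalker n).symm (toWalker n ψ))) = _
  rw [LinearEquiv.symm_apply_apply]

/-- The symmetric marked state `(|d,(0,0)⟩ + |d,(1,1)⟩) / √2`. -/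
noncomputable def pairState (n : ℕ) : State n :=
  ((1 / Real.sqrt 2 : ℝ) : ℂ) • (ket (0, 0) + ket (1, 1))

/-- The symmetric marked state as a vector of the Hilbert space. -/
noncomputable def pairVec (n : ℕ) [NeZero n] : Walker n := toWalker n (pairState n)

lemma inner_ket (m : Vertex n) (ψ : State n) :
    inner ℂ (toWalker n (ket m)) (toWalker n ψ) = bra m ψ := by
  rw [inner_toWalker, bra]
  refine sum_congr rfl fun v _ => ?_
  rw [sum_eq_single m]
  · simp [ket, mul_comm]
  · intro p _ hp; simp [ket, hp]
  · simp

lemma inner_pairVec (ψ : State n) :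
    inner ℂ (pairVec n) (toWalker n ψ) =
      ((1 / Real.sqrt 2 : ℝ) : ℂ) * (bra (0, 0) ψ + bra (1, 1) ψ) := by
  rw [pairVec, pairState, map_smul, map_add, inner_smul_left, inner_add_left, inner_ket, inner_ket,
    Complex.conj_ofReal]

lemma norm_pairVec (hn : 2 ≤ n) : ‖pairVec n‖ = 1 := by
  have : Fact (1 < n) := ⟨hn⟩
  have h : inner ℂ (pairVec n) (pairVec n) = (1 : ℂ) := by
    nth_rewrite 2 [pairVec]
    rw [inner_pairVec, pairState]
    have hb : ∀ m : Vertex n, bra m (((1 / Real.sqrt 2 : ℝ) : ℂ) • (ket (0, 0) + ket (1, 1))) =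
        ((1 / Real.sqrt 2 : ℝ) : ℂ) * (bra m (ket (0, 0)) + bra m (ket (1, 1))) := by
      intro m
      simp only [bra_eq, Pi.smul_apply, Pi.add_apply, smul_eq_mul]
      ring
    rw [hb, hb, bra_ket, bra_ket, bra_ket, bra_ket]
    simp only [Prod.mk.injEq, one_ne_zero, zero_ne_one, and_self, if_true, if_false]
    linear_combination 2 * sqrt_two_inv_mul_self
  have h2 : ‖pairVec n‖ ^ 2 = 1 := by
    rw [← inner_self_eq_norm_sq (𝕜 := ℂ), h]
    simp
  nlinarith [norm_nonneg (pairVec n)]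

/-- One step of the search on the flip-invariant states. -/
noncomputable def searchW (n : ℕ) [NeZero n] : Walker n ≃ₗᵢ[ℂ] Walker n :=
  (Submodule.reflection (ℂ ∙ pairVec n)ᗮ).trans (walkU n)

lemma searchW_apply (hn : 2 ≤ n) (x : Walker n) :
    searchW n x = walkU n (x - (2 * inner ℂ (pairVec n) x) • pairVec n) := by
  change walkU n (Submodule.reflection (ℂ ∙ pairVec n)ᗮ x) = _
  rw [Submodule.reflection_orthogonal_apply, Submodule.reflection_singleton_apply,
    norm_pairVec hn]
  congr 1
  simp only [Complex.coe_algebraMap, Complex.ofReal_one, one_pow, div_one]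
  module

/-- Flip invariance equates the two marked amplitudes, so the oracle subtracts a multiple of
`pairState`, exactly as the reflection in `searchW` does. -/
lemma toWalker_stateAt (hn : 2 ≤ n) (t : ℕ) :
    toWalker n (stateAt (diagonalPair n) t) = (searchW n ^ t) (toWalker n (initial n)) := by
  induction t with
  | zero => rfl
  | succ t ih =>
    have h := (flipInvariant_stateAt hn t).bra_eq
    have e : stateAt (diagonalPair n) (t + 1) =
        walk (oracle (diagonalPair n) (stateAt (diagonalPair n) t)) := by
      rw [stateAt, Function.iterate_succ_apply']; rfl
    have e2 : (searchW n ^ (t + 1)) (toWalker n (initial n)) =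
        searchW n ((searchW n ^ t) (toWalker n (initial n))) := by rw [pow_succ']; rfl
    rw [e, e2, ← ih, searchW_apply hn, inner_pairVec, pairVec, ← map_smul, ← map_sub,
      walkU_toWalker, oracle_diagonalPair hn, h, pairState, smul_smul]
    congr 3
    rw [show 2 * (((1 / Real.sqrt 2 : ℝ) : ℂ) * (bra (0, 0) (stateAt (diagonalPair n) t) +
      bra (0, 0) (stateAt (diagonalPair n) t))) * ((1 / Real.sqrt 2 : ℝ) : ℂ) =
      2 * bra (0, 0) (stateAt (diagonalPair n) t) by
        linear_combination (4 * bra (0, 0) (stateAt (diagonalPair n) t)) * sqrt_two_inv_mul_self]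
    rw [← smul_add, smul_smul]

lemma successProb_eq (hn : 2 ≤ n) (t : ℕ) :
    successProb (diagonalPair n) t =
      ‖inner ℂ (pairVec n) ((searchW n ^ t) (toWalker n (initial n)))‖ ^ 2 := by
  have : Fact (1 < n) := ⟨hn⟩
  have hne : ((0, 0) : Vertex n) ≠ (1, 1) := by simp
  rw [← toWalker_stateAt hn, inner_pairVec, successProb, diagonalPair, sum_pair hne]
  have h := (flipInvariant_stateAt hn t).bra_eq
  rw [diagonalPair] at h
  rw [h, ← two_mul, ← two_mul, norm_mul, norm_mul, mul_pow, mul_pow, Complex.norm_real, Complex.norm_ofNat,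
    Real.norm_of_nonneg (by positivity), div_pow, Real.sq_sqrt (by norm_num)]
  ring

lemma norm_toWalker_initial : ‖toWalker n (initial n)‖ = 1 := by
  have hn : (n : ℝ) ≠ 0 := Nat.cast_ne_zero.2 (NeZero.ne n)
  have h : ‖toWalker n (initial n)‖ ^ 2 = 1 := by
    rw [norm_sq_toWalker]
    simp only [initial, Complex.norm_real, norm_div, norm_one, div_pow, Real.norm_eq_abs, sq_abs]
    rw [Real.sq_sqrt (by positivity)]
    simp only [sum_const, card_univ, Fintype.card_fin, Fintype.card_prod, ZMod.card, nsmul_eq_mul]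
    push_cast
    field_simp
  nlinarith [norm_nonneg (toWalker n (initial n))]

lemma bra_initial (m : Vertex n) : bra m (initial n) = 1 / n := by
  have hn : (n : ℝ) ≠ 0 := Nat.cast_ne_zero.2 (NeZero.ne n)
  have h2 : √(2 : ℝ) ^ 2 = 2 := Real.sq_sqrt (by norm_num)
  have h : (1 / √2) * (1 / √(2 * (n : ℝ) ^ 2) + 1 / √(2 * (n : ℝ) ^ 2)) = 1 / n := by
    rw [Real.sqrt_mul (by norm_num), Real.sqrt_sq (by positivity)]
    field_simp
    rw [h2]; norm_num
  rw [bra_eq]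
  simp only [initial]
  rw [← Complex.ofReal_add, ← Complex.ofReal_mul, h]
  push_cast
  rfl

lemma norm_inner_pairVec_initial :
    ‖inner ℂ (pairVec n) (toWalker n (initial n))‖ = √2 / n := by
  rw [inner_pairVec, bra_initial, bra_initial, ← two_mul]
  have h2 : √(2 : ℝ) * √2 = 2 := Real.mul_self_sqrt (by norm_num)
  simp only [norm_mul, norm_div, Complex.norm_real, Complex.norm_natCast, Complex.norm_ofNat,
    norm_one, Real.norm_of_nonneg (Real.sqrt_nonneg 2)]
  rw [div_mul_eq_mul_div, div_eq_iff (by positivity)]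
  rw [div_mul_eq_mul_div, h2]
  ring

end Walk

/-! ### Plane waves and the explicit resolvent of the walk. -/

section Fourier

open Finset

variable {n : ℕ} [NeZero n]

/-- The plane wave of momentum `k` with coin amplitudes `u`. -/
noncomputable def mode (k : Vertex n) (u : Fin 2 → ℂ) : State n :=
  fun v p => u v * ZMod.stdAddChar (k.1 * p.1 + k.2 * p.2)

/-- The action of the walk on the coin amplitudes of the plane waves of momentum `k`. -/
noncomputable def bloch (k : Vertex n) (u : Fin 2 → ℂ) : Fin 2 → ℂ :=
  ![ZMod.stdAddChar k.2 * (cosZ k.1 * u 0 - sinZ k.1 * u 1),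
    ZMod.stdAddChar (-k.2) * (sinZ k.1 * u 0 + cosZ k.1 * u 1)]

lemma stdAddChar_neg_eq (k : ZMod n) :
    ZMod.stdAddChar (-k) = cosZ k - sinZ k * Complex.I := by
  rw [stdAddChar_eq, cosZ_neg, sinZ_neg]; push_cast; ring

lemma walk_mode (k : Vertex n) (u : Fin 2 → ℂ) : walk (mode k u) = mode k (bloch k u) := by
  have e : ∀ (p : Vertex n) (a b : ZMod n), ZMod.stdAddChar (k.1 * (p.1 + a) + k.2 * (p.2 + b)) =
      ZMod.stdAddChar (k.1 * p.1 + k.2 * p.2) * ZMod.stdAddChar (k.1 * a) *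
        ZMod.stdAddChar (k.2 * b) := by
    intro p a b
    rw [← AddChar.map_add_eq_mul, ← AddChar.map_add_eq_mul]
    congr 1
    ring
  have hI := Complex.I_sq
  funext v p
  fin_cases v
  · simp only [Fin.zero_eta, walk_apply_zero, mode, bloch, sub_eq_add_neg (p.1), e, mul_one,
      mul_neg, stdAddChar_neg_eq k.1, stdAddChar_eq k.1, Matrix.cons_val_zero]
    linear_combination (ZMod.stdAddChar (k.1 * p.1 + k.2 * p.2) * ZMod.stdAddChar k.2 *
      sinZ k.1 * u 1) * hI
  · simp only [Fin.mk_one, walk_apply_one, mode, bloch, sub_eq_add_neg (p.1),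
      sub_eq_add_neg (p.2), e, mul_one, mul_neg, stdAddChar_neg_eq k.1, stdAddChar_eq k.1,
      Matrix.cons_val_one, Matrix.cons_val_fin_one]
    linear_combination (-(ZMod.stdAddChar (k.1 * p.1 + k.2 * p.2) * ZMod.stdAddChar (-k.2) *
      sinZ k.1 * u 0)) * hI

/-- The characteristic polynomial `det (1 - r U)` of the walk at momentum `(k, l)`. -/
noncomputable def blochDet (r : ℝ) (k l : ZMod n) : ℝ := 1 - 2 * r * (cosZ k * cosZ l) + r ^ 2

/-- The coin matrix at momentum `(k, l)` has determinant `1` and trace `2 cos θ_k cos θ_l`. Hence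
`blochDet` equals `(1 - r)² + 2r (1 - cos θ_k cos θ_l)`. -/
lemma le_blochDet {r : ℝ} (h0 : 0 ≤ r) (k l : ZMod n) :
    (1 - r) ^ 2 + r * (sinZ k ^ 2 + sinZ l ^ 2) ≤ blochDet r k l := by
  have := mul_le_mul_of_nonneg_left (one_sub_cosZ_mul k l) h0
  simp only [blochDet]
  nlinarith

lemma blochDet_pos {r : ℝ} (h0 : 0 ≤ r) (h1 : r < 1) (k l : ZMod n) : 0 < blochDet r k l := by
  refine lt_of_lt_of_le ?_ (le_blochDet h0 k l)
  have : 0 < (1 - r) ^ 2 := by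
    have : 0 < 1 - r := by linarith
    positivity
  positivity

lemma blochDet_le {r : ℝ} (h0 : 0 ≤ r) (h1 : r < 1) (k l : ZMod n) : blochDet r k l ≤ 4 := by
  have := mul_le_mul_of_nonneg_left (neg_one_le_cosZ_mul k l) h0
  simp only [blochDet]
  nlinarith

/-- The solution of `(1 - r U) u = |d⟩` at momentum `k`. -/
noncomputable def blochResolvent (r : ℝ) (k : Vertex n) : Fin 2 → ℂ :=
  ![((1 / Real.sqrt 2 : ℝ) : ℂ) / blochDet r k.1 k.2 *
      (1 - r * (ZMod.stdAddChar (-k.2) * cosZ k.1 + ZMod.stdAddChar k.2 * sinZ k.1)),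
    ((1 / Real.sqrt 2 : ℝ) : ℂ) / blochDet r k.1 k.2 *
      (1 - r * (ZMod.stdAddChar k.2 * cosZ k.1 - ZMod.stdAddChar (-k.2) * sinZ k.1))]

lemma blochResolvent_sub {r : ℝ} (h0 : 0 ≤ r) (h1 : r < 1) (k : Vertex n) (v : Fin 2) :
    blochResolvent r k v - r * bloch k (blochResolvent r k) v = diag v := by
  have hD : (blochDet r k.1 k.2 : ℂ) ≠ 0 := by
    exact_mod_cast (blochDet_pos h0 h1 k.1 k.2).ne'
  have hPQ : ZMod.stdAddChar k.2 * ZMod.stdAddChar (-k.2) = 1 := by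
    rw [← AddChar.map_add_eq_mul, add_neg_cancel, AddChar.map_zero_eq_one]
  have hsum : ZMod.stdAddChar k.2 + ZMod.stdAddChar (-k.2) = 2 * (cosZ k.2 : ℂ) := by
    rw [stdAddChar_neg_eq, stdAddChar_eq]; ring
  have hcs : (cosZ k.1 : ℂ) ^ 2 + (sinZ k.1 : ℂ) ^ 2 = 1 := by
    exact_mod_cast cosZ_sq_add_sinZ_sq k.1
  have hDdef : (blochDet r k.1 k.2 : ℂ) = 1 - 2 * r * (cosZ k.1 * cosZ k.2) + r ^ 2 := by
    simp [blochDet]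
  rw [show diag v = ((1 / Real.sqrt 2 : ℝ) : ℂ) / blochDet r k.1 k.2 * blochDet r k.1 k.2 by
    rw [div_mul_cancel₀ _ hD]; rfl]
  nth_rewrite 2 [hDdef]
  generalize hA : ((1 / Real.sqrt 2 : ℝ) : ℂ) / blochDet r k.1 k.2 = A
  fin_cases v
  · simp only [blochResolvent, bloch, hA, Fin.zero_eta, Matrix.cons_val_zero, Matrix.cons_val_one,
      Matrix.cons_val_fin_one]
    linear_combination (-A * r * cosZ k.1) * hsum +
      (A * r ^ 2 * (cosZ k.1 ^ 2 + sinZ k.1 ^ 2)) * hPQ +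
      (A * r ^ 2) * hcs
  · simp only [blochResolvent, bloch, hA, Fin.mk_one, Matrix.cons_val_zero, Matrix.cons_val_one,
      Matrix.cons_val_fin_one]
    linear_combination (-A * r * cosZ k.1) * hsum +
      (A * r ^ 2 * (cosZ k.1 ^ 2 + sinZ k.1 ^ 2)) * hPQ +
      (A * r ^ 2) * hcs

lemma sum_stdAddChar_vertex (p : Vertex n) :
    ∑ k : Vertex n, ZMod.stdAddChar (k.1 * p.1 + k.2 * p.2) = if p = 0 then (n : ℂ) ^ 2 else 0 := by
  simp only [AddChar.map_add_eq_mul, Fintype.sum_prod_type]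
  rw [← sum_mul_sum, sum_stdAddChar_mul, sum_stdAddChar_mul]
  by_cases h1 : p.1 = 0 <;> by_cases h2 : p.2 = 0 <;> simp [h1, h2, Prod.ext_iff, sq]

/-- The resolvent of the walk at the symmetric marked state. -/
noncomputable def pairResolvent (n : ℕ) [NeZero n] (r : ℝ) : State n :=
  ∑ k : Vertex n, (((1 / Real.sqrt 2 : ℝ) : ℂ) / (n : ℂ) ^ 2 *
    (1 + ZMod.stdAddChar (-(k.1 + k.2)))) • mode k (blochResolvent r k)

lemma mode_sub_smul_walk {r : ℝ} (h0 : 0 ≤ r) (h1 : r < 1) (k : Vertex n) :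
    mode k (blochResolvent r k) - (r : ℂ) • walk (mode k (blochResolvent r k)) = mode k diag := by
  rw [walk_mode]
  funext v p
  simp only [Pi.sub_apply, Pi.smul_apply, smul_eq_mul, mode, ← blochResolvent_sub h0 h1 k v]
  ring

lemma pairResolvent_sub {r : ℝ} (h0 : 0 ≤ r) (h1 : r < 1) :
    pairResolvent n r - (r : ℂ) • walk (pairResolvent n r) = pairState n := by
  have hn : (n : ℂ) ≠ 0 := Nat.cast_ne_zero.2 (NeZero.ne n)
  have e : pairResolvent n r - (r : ℂ) • walk (pairResolvent n r) =
      ∑ k : Vertex n, (((1 / Real.sqrt 2 : ℝ) : ℂ) / (n : ℂ) ^ 2 *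
        (1 + ZMod.stdAddChar (-(k.1 + k.2)))) • mode k diag := by
    rw [← walkLin_apply, pairResolvent, map_sum, smul_sum, ← sum_sub_distrib]
    refine sum_congr rfl fun k _ => ?_
    rw [map_smul, smul_comm, ← smul_sub, walkLin_apply, mode_sub_smul_walk h0 h1]
  rw [e]
  funext v p
  have e2 : ∀ k : Vertex n, ZMod.stdAddChar (-(k.1 + k.2)) *
      ZMod.stdAddChar (k.1 * p.1 + k.2 * p.2) =
      ZMod.stdAddChar (k.1 * (p - (1, 1)).1 + k.2 * (p - (1, 1)).2) := by
    intro k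
    rw [← AddChar.map_add_eq_mul]
    congr 1
    simp only [Prod.fst_sub, Prod.snd_sub]
    ring
  have e3 : ∀ k : Vertex n, ((((1 / Real.sqrt 2 : ℝ) : ℂ) / (n : ℂ) ^ 2 *
        (1 + ZMod.stdAddChar (-(k.1 + k.2)))) • mode k diag) v p =
      ((1 / Real.sqrt 2 : ℝ) : ℂ) / (n : ℂ) ^ 2 * diag v *
        (ZMod.stdAddChar (k.1 * p.1 + k.2 * p.2) +
          ZMod.stdAddChar (k.1 * (p - (1, 1)).1 + k.2 * (p - (1, 1)).2)) := by
    intro k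
    rw [← e2]
    simp only [Pi.smul_apply, mode, smul_eq_mul]
    ring
  rw [Finset.sum_apply, Finset.sum_apply, sum_congr rfl fun k _ => e3 k, ← mul_sum,
    sum_add_distrib, sum_stdAddChar_vertex, sum_stdAddChar_vertex]
  simp only [pairState, Pi.smul_apply, Pi.add_apply, ket, smul_eq_mul, sub_eq_zero,
    Prod.mk_zero_zero]
  split_ifs <;> field_simp <;> ring

lemma inner_pairVec_mode (k : Vertex n) (u : Fin 2 → ℂ) :
    inner ℂ (pairVec n) (toWalker n (mode k u)) =
      1 / 2 * (u 0 + u 1) * (1 + ZMod.stdAddChar (k.1 + k.2)) := by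
  rw [inner_pairVec, bra_eq, bra_eq]
  simp only [mode, mul_zero, mul_one, add_zero, AddChar.map_zero_eq_one]
  linear_combination ((u 0 + u 1) * (1 + ZMod.stdAddChar (k.1 + k.2))) * sqrt_two_inv_mul_self

lemma sum_one_add_cosZ (hn : 2 ≤ n) :
    ∑ k : ZMod n, ∑ l : ZMod n, (1 + (cosZ k * cosZ l - sinZ k * sinZ l)) = (n : ℝ) ^ 2 := by
  simp only [sum_add_distrib, sum_cosZ_add hn]
  simp [sq]

/-- The Carathéodory function `⟨s|(1 + r U)(1 - r U)⁻¹|s⟩` of the walk at the symmetric marked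
state. -/
lemma inner_pairResolvent (hn : 2 ≤ n) {r : ℝ} (h0 : 0 ≤ r) (h1 : r < 1) :
    2 * inner ℂ (pairVec n) (toWalker n (pairResolvent n r)) - 1 =
      1 / (n : ℂ) ^ 2 * ∑ k : ZMod n, ∑ l : ZMod n,
        (((1 + (cosZ k * cosZ l - sinZ k * sinZ l)) * (1 - r ^ 2) / blochDet r k l : ℝ) -
          (2 * r * ((1 + (cosZ k * cosZ l - sinZ k * sinZ l)) *
            (sinZ k * sinZ l * (blochDet r k l)⁻¹)) : ℝ) * Complex.I) := by
  have hn0 : (n : ℂ) ≠ 0 := Nat.cast_ne_zero.2 (NeZero.ne n)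
  -- The weights `1 + cos (θ_k + θ_l)`, coming from `|1 + e^{i(θ_k + θ_l)}|²`, average to `1`; the
  -- subtracted `1` can then be absorbed mode by mode.
  have hone : (1 : ℂ) = 1 / (n : ℂ) ^ 2 * ∑ k : ZMod n, ∑ l : ZMod n,
      ((1 + (cosZ k * cosZ l - sinZ k * sinZ l) : ℝ) : ℂ) := by
    have h := congrArg (Complex.ofReal) (sum_one_add_cosZ hn)
    simp only [Complex.ofReal_sum, Complex.ofReal_pow, Complex.ofReal_natCast] at h
    rw [h]
    field_simp
  nth_rewrite 1 [hone]
  rw [pairResolvent, map_sum, inner_sum, Fintype.sum_prod_type, mul_sum, mul_sum, mul_sum,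
    ← sum_sub_distrib]
  refine sum_congr rfl fun k _ => ?_
  rw [mul_sum, mul_sum, mul_sum, ← sum_sub_distrib]
  refine sum_congr rfl fun l _ => ?_
  rw [map_smul, inner_smul_right, inner_pairVec_mode]
  have hD : (blochDet r k l : ℂ) ≠ 0 := by
    exact_mod_cast (blochDet_pos h0 h1 k l).ne'
  have hD' : (blochDet r k l : ℂ) = 1 - 2 * r * (cosZ k * cosZ l) + r ^ 2 := by
    simp [blochDet]
  have hw : blochResolvent r (k, l) 0 + blochResolvent r (k, l) 1 =
      ((1 / Real.sqrt 2 : ℝ) : ℂ) / blochDet r k l *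
        (2 - 2 * r * (cosZ k * cosZ l + sinZ k * sinZ l * Complex.I)) := by
    simp only [blochResolvent, Matrix.cons_val_zero, Matrix.cons_val_one]
    rw [stdAddChar_neg_eq, stdAddChar_eq]
    ring
  have hχ : (1 + ZMod.stdAddChar (-(k + l))) * (1 + ZMod.stdAddChar (k + l)) =
      2 * (1 + (cosZ k * cosZ l - sinZ k * sinZ l) : ℂ) := by
    have hPQ : ZMod.stdAddChar (-(k + l)) * ZMod.stdAddChar (k + l) = 1 := by
      rw [← AddChar.map_add_eq_mul, neg_add_cancel, AddChar.map_zero_eq_one]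
    have hPQ2 : ZMod.stdAddChar (-(k + l)) + ZMod.stdAddChar (k + l) =
        2 * (cosZ k * cosZ l - sinZ k * sinZ l : ℂ) := by
      rw [neg_add, AddChar.map_add_eq_mul, AddChar.map_add_eq_mul, stdAddChar_neg_eq,
        stdAddChar_neg_eq, stdAddChar_eq, stdAddChar_eq]
      linear_combination (2 * sinZ k * sinZ l : ℂ) * Complex.I_sq
    linear_combination hPQ + hPQ2
  rw [hw]
  have e : 2 * (((1 / Real.sqrt 2 : ℝ) : ℂ) / (n : ℂ) ^ 2 * (1 + ZMod.stdAddChar (-(k + l))) *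
      (1 / 2 * (((1 / Real.sqrt 2 : ℝ) : ℂ) / blochDet r k l *
        (2 - 2 * r * (cosZ k * cosZ l + sinZ k * sinZ l * Complex.I))) *
        (1 + ZMod.stdAddChar (k + l)))) =
      (((1 / Real.sqrt 2 : ℝ) : ℂ) * ((1 / Real.sqrt 2 : ℝ) : ℂ)) *
      ((1 + ZMod.stdAddChar (-(k + l))) * (1 + ZMod.stdAddChar (k + l))) / (n : ℂ) ^ 2 *
      ((2 - 2 * r * (cosZ k * cosZ l + sinZ k * sinZ l * Complex.I)) / blochDet r k l) := by
    ring
  rw [e, hχ, sqrt_two_inv_mul_self]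
  push_cast
  field_simp
  rw [hD']
  ring

/-- The real part of the Carathéodory function. -/
lemma re_inner_pairResolvent (hn : 2 ≤ n) {r : ℝ} (h0 : 0 ≤ r) (h1 : r < 1) :
    (2 * inner ℂ (pairVec n) (toWalker n (pairResolvent n r)) - 1 : ℂ).re =
      1 / (n : ℝ) ^ 2 * ∑ k : ZMod n, ∑ l : ZMod n,
        (1 + (cosZ k * cosZ l - sinZ k * sinZ l)) * (1 - r ^ 2) / blochDet r k l := by
  rw [inner_pairResolvent hn h0 h1]
  have : (1 / (n : ℂ) ^ 2) = ((1 / (n : ℝ) ^ 2 : ℝ) : ℂ) := by push_cast; rfl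
  rw [this, Complex.re_ofReal_mul]
  simp only [Complex.re_sum, Complex.sub_re, Complex.ofReal_re, Complex.re_ofReal_mul,
    Complex.I_re, mul_zero, sub_zero]

/-- The imaginary part of the Carathéodory function. -/
lemma im_inner_pairResolvent (hn : 2 ≤ n) {r : ℝ} (h0 : 0 ≤ r) (h1 : r < 1) :
    (2 * inner ℂ (pairVec n) (toWalker n (pairResolvent n r)) - 1 : ℂ).im =
      2 * r / (n : ℝ) ^ 2 * ∑ k : ZMod n, ∑ l : ZMod n,
        sinZ k ^ 2 * sinZ l ^ 2 * (blochDet r k l)⁻¹ := by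
  rw [inner_pairResolvent hn h0 h1]
  have : (1 / (n : ℂ) ^ 2) = ((1 / (n : ℝ) ^ 2 : ℝ) : ℂ) := by push_cast; rfl
  rw [this, Complex.im_ofReal_mul]
  simp only [Complex.im_sum, Complex.sub_im, Complex.ofReal_im, Complex.im_ofReal_mul,
    Complex.I_im, mul_one, zero_sub, sum_neg_distrib]
  -- The `1` in the weight, the contribution of each marked vertex alone, is odd and vanishes
  -- (`e2`); the cross term is sign-definite (`e1`).
  have e1 := sum_cos_add_mul (n := n) (fun x => (1 - 2 * r * x + r ^ 2)⁻¹)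
  have e2 := sum_sinZ_mul_sinZ_eq_zero (n := n) (fun c d => (1 - 2 * r * (c * d) + r ^ 2)⁻¹)
  simp only [add_mul, one_mul, mul_add, sum_add_distrib, ← mul_sum, blochDet, e1, e2]
  ring

end Fourier

/-! ### Success probability, time complexity and non-optimality. -/

section Bounds

open Finset

lemma re_inv_le {z : ℂ} {κ : ℝ} (hκ : 0 < κ) (hre : 0 ≤ z.re) (him : κ ≤ z.im) :
    z⁻¹.re ≤ z.re / κ ^ 2 := by
  rw [Complex.inv_re]
  have : κ ^ 2 ≤ Complex.normSq z := by
    rw [Complex.normSq_apply]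
    nlinarith [mul_self_nonneg z.re]
  gcongr

variable {n : ℕ} [NeZero n]

/-- The constructive interference keeps the Carathéodory function away from zero. -/
lemma le_im_inner_pairResolvent (hn : 3 ≤ n) {r : ℝ} (h0 : 1 / 2 ≤ r) (h1 : r < 1) :
    1 / 16 ≤ (2 * inner ℂ (pairVec n) (toWalker n (pairResolvent n r)) - 1 : ℂ).im := by
  have hn0 : (0 : ℝ) < n := Nat.cast_pos.2 (by omega)
  have hr : 0 ≤ r := by linarith
  rw [im_inner_pairResolvent (by omega) hr h1]
  have h := le_sum_sinZ_sq_mul hn (f := fun x => (1 - 2 * r * x + r ^ 2)⁻¹) (δ := 1 / 4) (by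
    intro k l
    have h2 : 1 / 4 ≤ (blochDet r k l)⁻¹ := by
      rw [one_div]
      exact inv_anti₀ (blochDet_pos hr h1 k l) (blochDet_le hr h1 k l)
    rw [mul_comm]
    exact mul_le_mul_of_nonneg_left h2 (by positivity))
  calc (1 : ℝ) / 16 ≤ 2 * r / n ^ 2 * (1 / 4 * n ^ 2 / 4) := by
        rw [div_mul_eq_mul_div, le_div_iff₀ (by positivity)]
        nlinarith [sq_nonneg (n : ℝ)]
    _ ≤ _ := mul_le_mul_of_nonneg_left h (by positivity)

lemma re_inner_pairResolvent_nonneg (hn : 2 ≤ n) {r : ℝ} (h0 : 0 ≤ r) (h1 : r < 1) :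
    0 ≤ (2 * inner ℂ (pairVec n) (toWalker n (pairResolvent n r)) - 1 : ℂ).re := by
  rw [re_inner_pairResolvent hn h0 h1]
  refine mul_nonneg (by positivity) (sum_nonneg fun k _ => sum_nonneg fun l _ => ?_)
  have hc := (cosZ_add_mem k l).1
  exact div_nonneg (mul_nonneg (by linarith) (by nlinarith)) (blochDet_pos h0 h1 k l).le

lemma re_inner_pairResolvent_le (hn : 2 ≤ n) {ε : ℝ} (h0 : 0 < ε) (h1 : ε ≤ 1 / 2) :
    (2 * inner ℂ (pairVec n) (toWalker n (pairResolvent n (1 - ε))) - 1 : ℂ).re ≤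
      4 / (n : ℝ) ^ 2 * ∑ k : ZMod n, ∑ l : ZMod n,
        ε / (ε ^ 2 + (sinZ k ^ 2 + sinZ l ^ 2) / 2) := by
  rw [re_inner_pairResolvent hn (by linarith) (by linarith), div_eq_mul_one_div (4 : ℝ),
    mul_comm (4 : ℝ), mul_assoc]
  refine mul_le_mul_of_nonneg_left ?_ (by positivity)
  rw [mul_sum]
  refine sum_le_sum fun k _ => ?_
  rw [mul_sum]
  refine sum_le_sum fun l _ => ?_
  obtain ⟨hc0, hc1⟩ := cosZ_add_mem k l
  have hD := le_blochDet (show 0 ≤ 1 - ε by linarith) k l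
  have hs : 0 ≤ sinZ k ^ 2 + sinZ l ^ 2 := by positivity
  have hD' : ε ^ 2 + (sinZ k ^ 2 + sinZ l ^ 2) / 2 ≤ blochDet (1 - ε) k l := by nlinarith
  rw [← mul_div_assoc]
  have hnum : (1 + (cosZ k * cosZ l - sinZ k * sinZ l)) * (1 - (1 - ε) ^ 2) ≤ 4 * ε := by
    have : 1 - (1 - ε) ^ 2 ≤ 2 * ε := by nlinarith
    have h3 : 0 ≤ 1 - (1 - ε) ^ 2 := by nlinarith
    calc _ ≤ 2 * (2 * ε) := mul_le_mul (by linarith) this h3 (by norm_num)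
      _ = 4 * ε := by ring
  exact div_le_div₀ (by positivity) hnum (by positivity) hD'

lemma sum_re_inv_le (hn : 3 ≤ n) {J : ℕ} (hJ : 2 ^ J ≤ 2 * n ^ 2) :
    ∑ j ∈ range J, (2 * inner ℂ (pairVec n)
      (toWalker n (pairResolvent n (1 - (1 / 2) ^ (j + 1)))) - 1 : ℂ)⁻¹.re ≤ 540672 := by
  have hn0 : (0 : ℝ) < n := Nat.cast_pos.2 (by omega)
  have hterm : ∀ j ∈ range J, (2 * inner ℂ (pairVec n)
      (toWalker n (pairResolvent n (1 - (1 / 2) ^ (j + 1)))) - 1 : ℂ)⁻¹.re ≤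
      1024 / (n : ℝ) ^ 2 * ∑ k : ZMod n, ∑ l : ZMod n,
        (1 / 2) ^ (j + 1) / (((1 / 2) ^ (j + 1)) ^ 2 + (sinZ k ^ 2 + sinZ l ^ 2) / 2) := by
    intro j _
    have he : (0 : ℝ) < (1 / 2) ^ (j + 1) := by positivity
    have he1 : (1 / 2 : ℝ) ^ (j + 1) ≤ 1 / 2 := by
      have := pow_le_pow_of_le_one (show (0 : ℝ) ≤ 1 / 2 by norm_num) (by norm_num)
        (show 1 ≤ j + 1 by omega)
      simpa using this
    have h1 := re_inner_pairResolvent_nonneg (n := n) (by omega)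
      (show (0 : ℝ) ≤ 1 - (1 / 2) ^ (j + 1) by linarith) (by linarith)
    have h2 := le_im_inner_pairResolvent hn
      (show (1 / 2 : ℝ) ≤ 1 - (1 / 2) ^ (j + 1) by linarith) (by linarith)
    refine (re_inv_le (by norm_num) h1 h2).trans ?_
    have h3 := re_inner_pairResolvent_le (n := n) (by omega) he he1
    rw [div_le_iff₀ (by norm_num)]
    refine h3.trans (le_of_eq ?_)
    ring
  refine (sum_le_sum hterm).trans ?_
  rw [← mul_sum]
  -- The constant is `540672 = 1024 · 528`, where `1024 = 4 · 16²` combines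
  -- `re_inner_pairResolvent_le` with the lower bound `1/16` on the imaginary part.
  refine (mul_le_mul_of_nonneg_left (sum_dyadic_zmod_le hJ) (by positivity)).trans (le_of_eq ?_)
  field_simp
  norm_num

lemma successProb_le_one (hn : 2 ≤ n) (t : ℕ) : successProb (diagonalPair n) t ≤ 1 := by
  rw [successProb_eq hn]
  have h := norm_inner_le_norm (𝕜 := ℂ) (pairVec n) ((searchW n ^ t) (toWalker n (initial n)))
  rw [(searchW n ^ t).norm_map, norm_toWalker_initial, norm_pairVec hn, one_mul] at h
  exact pow_le_one₀ (norm_nonneg _) h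

theorem successProb_le : ∃ C : ℝ, 0 < C ∧ ∀ n : ℕ, 2 ≤ n → ∀ t : ℕ,
    successProb (diagonalPair n) t ≤ C / (n : ℝ) ^ 2 := by
  obtain ⟨B, hBdef⟩ : ∃ B : ℝ, B = 540672 := ⟨_, rfl⟩
  have hB0 : 0 ≤ B := by rw [hBdef]; norm_num
  -- The summand `4` covers `n = 2`, where no interference is available but `p(t) ≤ 1 = 4/N`.
  refine ⟨4 + (√B + 2 * √2 * (√(2 * B) + B)) ^ 2, by positivity, fun n hn t => ?_⟩
  have : NeZero n := ⟨by omega⟩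
  have hn0 : (0 : ℝ) < n := Nat.cast_pos.2 (by omega)
  rcases hn.eq_or_lt with rfl | hn3
  · refine (successProb_le_one le_rfl t).trans ?_
    rw [le_div_iff₀ (by positivity)]
    push_cast
    nlinarith [sq_nonneg (√B + 2 * √2 * (√(2 * B) + B))]
  have hn3 : 3 ≤ n := hn3
  have hsq : n ^ 2 ≠ 0 := by positivity
  -- The last scale is of order `1/N`: large enough for the zero modes to cost `O(1)`, small enough
  -- for the remainder `√(ε B)` to be `O(1/n)`.
  have hJ1 : 2 ^ (Nat.log 2 (n ^ 2) + 1) ≤ 2 * n ^ 2 := by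
    have := Nat.pow_log_le_self 2 hsq
    rw [pow_succ]
    omega
  have hJ2 : (n : ℝ) ^ 2 ≤ 2 ^ (Nat.log 2 (n ^ 2) + 1) := by
    exact_mod_cast (Nat.lt_pow_succ_log_self one_lt_two (n ^ 2)).le
  have hε : ∀ j : ℕ, (0 : ℝ) ≤ 1 - (1 / 2) ^ (j + 1) ∧ (1 - (1 / 2 : ℝ) ^ (j + 1)) < 1 ∧
      1 / 2 ≤ 1 - (1 / 2 : ℝ) ^ (j + 1) := by
    intro j
    have h1 : (0 : ℝ) < (1 / 2) ^ (j + 1) := by positivity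
    have h2 := pow_le_pow_of_le_one (show (0 : ℝ) ≤ 1 / 2 by norm_num) (by norm_num)
        (show 1 ≤ j + 1 by omega)
    rw [pow_one] at h2
    refine ⟨by linarith, by linarith, by linarith⟩
  have key := norm_inner_pow_le (walkU n) (searchW n) (norm_pairVec hn) norm_toWalker_initial
    (by rw [walkU_toWalker, walk_initial]) (searchW_apply hn)
    (fun j => toWalker n (pairResolvent n (1 - (1 / 2) ^ (j + 1))))
    (fun j => by
      rw [walkU_toWalker, ← map_smul, ← map_sub, pairResolvent_sub (hε j).1 (hε j).2.1, pairVec])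
    (fun j h => by
      have := le_im_inner_pairResolvent hn3 (hε j).2.2 (hε j).2.1
      rw [h] at this
      norm_num at this)
    (Nat.log 2 (n ^ 2)) (sum_re_inv_le hn3 hJ1) t
  rw [← hBdef, norm_inner_pairVec_initial] at key
  have hroot : √((1 / 2) ^ (Nat.log 2 (n ^ 2) + 1) * B) ≤ √B / n := by
    have e : √B / n = √(B / n ^ 2) := by rw [Real.sqrt_div hB0, Real.sqrt_sq hn0.le]
    rw [e]
    apply Real.sqrt_le_sqrt
    rw [one_div, inv_pow, inv_mul_eq_div]
    gcongr
  rw [successProb_eq hn]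
  have hle : ‖inner ℂ (pairVec n) ((searchW n ^ t) (toWalker n (initial n)))‖ ≤
      (√B + 2 * √2 * (√(2 * B) + B)) / n := by
    refine key.trans ((add_le_add_left hroot _).trans (le_of_eq ?_))
    ring
  refine (pow_le_pow_left₀ (norm_nonneg _) hle 2).trans ?_
  rw [div_pow]
  gcongr
  linarith

lemma successProb_zero (hn : 2 ≤ n) : successProb (diagonalPair n) 0 = 2 / (n : ℝ) ^ 2 := by
  rw [successProb_eq hn]
  change ‖inner ℂ (pairVec n) (toWalker n (initial n))‖ ^ 2 = _
  rw [norm_inner_pairVec_initial, div_pow, Real.sq_sqrt (by norm_num)]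

theorem complexity_bounds : ∃ c C : ℝ, 0 < c ∧ ∀ n : ℕ, 2 ≤ n →
    ENNReal.ofReal (c * (n : ℝ) ^ 2) ≤ complexity (diagonalPair n) ∧
    complexity (diagonalPair n) ≤ ENNReal.ofReal (C * (n : ℝ) ^ 2) := by
  obtain ⟨C, hC, hp⟩ := successProb_le
  refine ⟨C⁻¹, 1 / 2, by positivity, fun n hn => ?_⟩
  have : NeZero n := ⟨by omega⟩
  have hn0 : (0 : ℝ) < n := Nat.cast_pos.2 (by omega)
  constructor
  · refine le_iInf fun t => ?_
    calc ENNReal.ofReal (C⁻¹ * (n : ℝ) ^ 2) = 1 / ENNReal.ofReal (C / (n : ℝ) ^ 2) := by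
          rw [one_div, ← ENNReal.ofReal_inv_of_pos (by positivity), inv_div, inv_mul_eq_div]
      _ ≤ ((t : ℝ≥0∞) + 1) / ENNReal.ofReal (successProb (diagonalPair n) t) :=
          ENNReal.div_le_div le_add_self (ENNReal.ofReal_le_ofReal (hp n hn t))
  · refine (iInf_le _ 0).trans (le_of_eq ?_)
    rw [successProb_zero hn, Nat.cast_zero, zero_add, one_div,
      ← ENNReal.ofReal_inv_of_pos (by positivity), inv_div]
    congr 1
    ring

theorem not_isOptimal_of_le {M : ∀ n : ℕ, Finset (Vertex n)} {c : ℝ} (hc : 0 < c)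
    (h : ∀ n : ℕ, 2 ≤ n → ENNReal.ofReal (c * (n : ℝ) ^ 2) ≤ complexity (M n)) :
    ¬ IsOptimal M := by
  rintro ⟨k, C, hC⟩
  have hlo : (fun x : ℝ => Real.log x ^ k) =o[Filter.atTop] fun x : ℝ => x ^ (1 / 2 : ℝ) := by
    have := isLittleO_log_rpow_rpow_atTop (k : ℝ) (show (0 : ℝ) < 1 / 2 by norm_num)
    simpa using this
  have htend : Filter.Tendsto (fun n : ℕ => (n : ℝ) ^ 2) Filter.atTop Filter.atTop :=
    (Filter.tendsto_pow_atTop two_ne_zero).comp tendsto_natCast_atTop_atTop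
  -- With this constant the claimed upper bound is at most `c n² / 2`, contradicting the lower bound
  -- `c n²`.
  have hb := (hlo.comp_tendsto htend).bound (show 0 < c / (2 * (|C| + 1)) by positivity)
  obtain ⟨n, hn2, hn, hnb⟩ := ((Filter.eventually_ge_atTop 2).and (hC.and hb)).exists
  have hn0 : (0 : ℝ) < n := Nat.cast_pos.2 (by omega)
  have h1 := (h n hn2).trans hn
  have h2 := (ENNReal.ofReal_le_ofReal_iff').1 h1
  simp only [Function.comp_apply, ← Real.sqrt_eq_rpow, Real.sqrt_sq hn0.le] at hnb
  rw [Real.norm_of_nonneg hn0.le] at hnb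
  have hpos : 0 < c * (n : ℝ) ^ 2 := by positivity
  rcases h2 with h2 | h2
  · have h3 : C * n * Real.log ((n : ℝ) ^ 2) ^ k ≤ |C| * n * |Real.log ((n : ℝ) ^ 2) ^ k| :=
      (le_abs_self _).trans_eq (by rw [abs_mul, abs_mul, abs_of_pos hn0])
    have h4 : |C| * n * |Real.log ((n : ℝ) ^ 2) ^ k| ≤ |C| * n * (c / (2 * (|C| + 1)) * n) := by
      gcongr
      exact hnb
    have h5 : |C| * n * (c / (2 * (|C| + 1)) * n) = c * n ^ 2 * (|C| / (2 * (|C| + 1))) := by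
      ring
    have h6 : |C| / (2 * (|C| + 1)) ≤ 1 / 2 := by
      rw [div_le_div_iff₀ (by positivity) (by norm_num)]
      linarith
    have h7 := mul_le_mul_of_nonneg_left h6 hpos.le
    linarith
  · linarith

lemma card_diagonalPair {n : ℕ} (hn : 2 ≤ n) : (diagonalPair n).card = 2 := by
  have : Fact (1 < n) := ⟨hn⟩
  exact card_pair (by simp)

end Bounds

end QWSearch

theorem mainTheorem3 :
    -- some two-element configurations are not optimal
    (∃ M : ∀ n : ℕ, Finset (QWSearch.Vertex n),
      (∀ n : ℕ, 2 ≤ n → (M n).card = 2) ∧ ¬ QWSearch.IsOptimal M) ∧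
    -- for the marked set `{(0,0), (1,1)}`, the interference term is of order `N`
    ((fun n : ℕ => QWSearch.interference n 1 1) =Θ[Filter.atTop] fun n : ℕ => (n : ℝ) ^ 2) ∧
    -- for it, the success probability is `O(1/N)`, whatever the number of steps
    (∃ C : ℝ, ∀ n : ℕ, 2 ≤ n → ∀ t : ℕ,
      QWSearch.successProb (QWSearch.diagonalPair n) t ≤ C / (n : ℝ) ^ 2) ∧
    -- for it, the time complexity is of order `N`, and the search is not optimal
    (∃ c C : ℝ, 0 < c ∧ ∀ n : ℕ, 2 ≤ n →
      ENNReal.ofReal (c * (n : ℝ) ^ 2) ≤ QWSearch.complexity (QWSearch.diagonalPair n) ∧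
      QWSearch.complexity (QWSearch.diagonalPair n) ≤ ENNReal.ofReal (C * (n : ℝ) ^ 2)) ∧
    ¬ QWSearch.IsOptimal QWSearch.diagonalPair := by
  obtain ⟨c, C, hc, hcC⟩ := QWSearch.complexity_bounds
  obtain ⟨K, -, hK⟩ := QWSearch.successProb_le
  have hopt := QWSearch.not_isOptimal_of_le hc fun n hn => (hcC n hn).1
  exact ⟨⟨QWSearch.diagonalPair, fun n hn => QWSearch.card_diagonalPair hn, hopt⟩,
    QWSearch.interference_isTheta, ⟨K, hK⟩, ⟨c, C, hc, hcC⟩, hopt⟩
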